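/- **Definitions.** Let $D=\{0,1\}$, let $E$ be a finite set and $\varphi:D\to E$ a map. A finite promise template $\Gamma$ over $(D,E,\varphi)$ is a finite family of pairs of relations $P_i\subseteq D^{\mathrm{ar}_i}$, $Q_i\subseteq E^{\mathrm{ar}_i}$ $(i\in I)$ such that $\varphi(P_i)\subseteq Q_i$ coordinatewise for all $i$. $\mathrm{PCSP}(\Gamma)$ is the promise decision problem whose inputs are formulas $\Psi=\bigwedge_{t}R_{i_t}(x_{t_1},\dots,x_{t_{\mathrm{ar}_{i_t}}})$ in variables $x_1,\dots,x_n$: accept if $\Psi$ is satisfiable over $D$ when every $R_i$ is read as $P_i$; reject if $\Psi$ is not satisfiable over $E$ when every $R_i$ is read as $Q_i$. A function $f:D^L\to E$, $L\ge 1$, is in $\mathrm{Pol}(\Gamma)$ if for all $i$, applying $f$ coordinatewise to any $L$ elements of $P_i$ gives an element of $Q_i$. A subring $A\subset\mathbb R$ (with $1$), whose elements are represented by bit strings, $\mathrm{size}(a)$ being the length of the given representation of $a$, is *efficiently computable* if: (1) a representation of $n\in\mathbb Z$ of size $\mathrm{poly}(\log(|n|+1))$ can be computed in polynomial time from the binary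 notation of $n$; (2) $2^{-\mathrm{poly}(\mathrm{size}(a))}<a<2^{\mathrm{poly}(\mathrm{size}(a))}$ for all $a\in A$, $a>0$; (3) $+,-,\times,=,<$ are computable in polynomial time on representations; (4) there is a constant $C>0$ such that the result of each of $+,-,\times$ on $a,a'$ has size at most $C(\mathrm{size}(a)+\mathrm{size}(a'))$. It is *LP-solvable* if moreover there is an algorithm that, given $M\in\mathbb Z^{m\times n}$ and $c\in\mathbb Z^m$, in time polynomial in $n+m$ and the bit size of $(M,c)$ outputs some $x\in A^n$ with $Mx\le c$, or reports that no such $x\in A^n$ exists. Let $A_1,\dots,A_b$ be dense subrings of $\mathbb R$, $\mathfrak A=(A_1\times\cdots\times A_b)\cap[0,1]^b$, and $S$ a finite set. A map $\mathrm{Part}:\mathfrak A\to S$ is an *open partition* if every $x\in\mathfrak A$ has an $\epsilon>0$ with $\mathrm{Part}(y)=\mathrm{Part}(x)$ for all $y\in\mathfrak A$ with $|x-y|<\epsilon$. For $x\in[0,1]^b$ put $\overline{\mathrm{Part}}(x)=k$ if for some $\epsilon>0$ we have $\mathrm{Part}(y)=k$ for all $y\in\mathfrak A$ with $|x-y|<\epsilon$,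 and $\overline{\mathrm{Part}}(x)=\perp$ if there is no such $k\in S$. For $k\in S$ let $J_k$ be an ideal of the ring $\mathbb Z^b$ with $\mathbb Z^b/J_k$ finite and let $M_k:\mathbb Z^b/J_k\to E$ be a map; $\mathcal M=\{M_k:k\in S\}$. Let $\mathcal B=(B_1,\dots,B_b)$ be a partition of $\{1,\dots,L\}$ into nonempty blocks such that $\overline{\mathrm{Part}}(k_1/|B_1|,\dots,k_b/|B_b|)\ne\perp$ for all integers $0\le k_j\le|B_j|$. With $\mathrm{Ham}_{B_j}(x)=\sum_{l\in B_j}x_l$, the function $\mathrm{REG\text{-}PER}_{\mathrm{Part},\mathcal B,\mathcal M}:D^L\to E$ is $$x\mapsto M_k\bigl((\mathrm{Ham}_{B_1}(x),\dots,\mathrm{Ham}_{B_b}(x))\bmod J_k\bigr),\qquad k=\overline{\mathrm{Part}}\Bigl(\tfrac{\mathrm{Ham}_{B_1}(x)}{|B_1|},\dots,\tfrac{\mathrm{Ham}_{B_b}(x)}{|B_b|}\Bigr).$$ **Theorem.** Let $A_1,\dots,A_b\subset\mathbb R$ be dense LP-solvable subrings, $\mathrm{Part}:\mathfrak A\to S$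 an open partition into finitely many regions, $\mathcal M=\{M_k:\mathbb Z^b/J_k\to E\mid k\in S\}$ a collection of maps as above, with all $\mathbb Z^b/J_k$ finite, and $\Gamma$ a finite promise template over $(\{0,1\},E,\varphi)$ with $E$ finite. Assume that for every positive integer $\ell$ there is a partition $\mathcal B$ as above with $|B_j|\ge\ell$ for all $j$ and $\mathrm{REG\text{-}PER}_{\mathrm{Part},\mathcal B,\mathcal M}\in\mathrm{Pol}(\Gamma)$. Then $\mathrm{PCSP}(\Gamma)\in\mathsf P^{\mathrm{Part}}$: the promise decision problem $\mathrm{PCSP}(\Gamma)$ can be solved in polynomial time by a machine with oracle access to $\mathrm{Part}$ (a query consists of representations of the coordinates of a point of $\mathfrak A$; the answer is the index of its region). -/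

import Mathlib

namespace PromiseCSP

/-! ### Machines, running time and oracles -/

/-- Programs of a machine with finitely many pushdown tapes over `{0, 1}`. Register `r` is a stack
of bits (its top is the head of the list). Every basic instruction touches the top of one stack
and costs one step, so up to constant factors this is the multitape Turing machine with a query
tape: `query r` replaces the contents `w` of register `r` by the oracle answer to `w`. -/
inductive Prog : Type
  | skip : Prog
  | push (r : ℕ) (a : Bool) : Prog
  | pop (r : ℕ) : Prog
  | query (r : ℕ) : Prog
  | seq (c d : Prog) : Prog
  /-- Branch on the top of register `r`: empty stack, top bit `0`, top bit `1`. -/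
  | test (r : ℕ) (cEmpty cZero cOne : Prog) : Prog
  /-- Repeat `c` as long as register `r` is nonempty. -/
  | loop (r : ℕ) (c : Prog) : Prog

/-- The contents of the registers. A program mentions only finitely many of them. -/
abbrev Store := ℕ → List Bool

/-- The program never consults the oracle. -/
def Prog.QueryFree : Prog → Prop
  | .skip => True
  | .push _ _ => True
  | .pop _ => True
  | .query _ => False
  | .seq c d => c.QueryFree ∧ d.QueryFree
  | .test _ c d e => c.QueryFree ∧ d.QueryFree ∧ e.QueryFree
  | .loop _ c => c.QueryFree

/-- `Exec O c s s' t`: started in the store `s`, with oracle `O`, the program `c` halts in the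
store `s'` after exactly `t` steps. -/
inductive Exec (O : List Bool → List Bool) : Prog → Store → Store → ℕ → Prop
  | skip (s : Store) : Exec O .skip s s 1
  | push (r : ℕ) (a : Bool) (s : Store) :
      Exec O (.push r a) s (Function.update s r (a :: s r)) 1
  | pop (r : ℕ) (s : Store) : Exec O (.pop r) s (Function.update s r (s r).tail) 1
  | query (r : ℕ) (s : Store) : Exec O (.query r) s (Function.update s r (O (s r))) 1
  | seq {c d : Prog} {s₁ s₂ s₃ : Store} {t u : ℕ} :
      Exec O c s₁ s₂ t → Exec O d s₂ s₃ u → Exec O (.seq c d) s₁ s₃ (t + u)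
  | test_empty {r : ℕ} {c d e : Prog} {s s' : Store} {t : ℕ} :
      s r = [] → Exec O c s s' t → Exec O (.test r c d e) s s' (t + 1)
  | test_zero {r : ℕ} {c d e : Prog} {s s' : Store} {t : ℕ} {l : List Bool} :
      s r = false :: l → Exec O d s s' t → Exec O (.test r c d e) s s' (t + 1)
  | test_one {r : ℕ} {c d e : Prog} {s s' : Store} {t : ℕ} {l : List Bool} :
      s r = true :: l → Exec O e s s' t → Exec O (.test r c d e) s s' (t + 1)
  | loop_done {r : ℕ} {c : Prog} {s : Store} : s r = [] → Exec O (.loop r c) s s 1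
  | loop_step {r : ℕ} {c : Prog} {s₁ s₂ s₃ : Store} {t u : ℕ} :
      s₁ r ≠ [] → Exec O c s₁ s₂ t → Exec O (.loop r c) s₂ s₃ u →
      Exec O (.loop r c) s₁ s₃ (t + u + 1)

/-- The initial store: the input is in register `0`, all other registers are empty. -/
def inputStore (w : List Bool) : Store := fun r => if r = 0 then w else []

/-- On input `w` the program halts after exactly `t` steps with `out` in register `0`. -/
def Computes (O : List Bool → List Bool) (c : Prog) (w out : List Bool) (t : ℕ) : Prop :=
  ∃ s' : Store, Exec O c (inputStore w) s' t ∧ s' 0 = out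

/-- `c` solves a computational problem in polynomial time: the instances `i : ι` are presented as
the bit strings `inp i`, and `R i out` says that `out` is a correct answer to the instance `i`. -/
def SolvesInPolyTime {ι : Type*} (O : List Bool → List Bool) (c : Prog)
    (inp : ι → List Bool) (R : ι → List Bool → Prop) : Prop :=
  ∃ p : Polynomial ℕ, ∀ i : ι, ∃ (out : List Bool) (t : ℕ),
    Computes O c (inp i) out t ∧ t ≤ p.eval (inp i).length ∧ R i out

/-- Solvable in polynomial time, without an oracle. -/
def PolyTimeSolvable {ι : Type*} (inp : ι → List Bool) (R : ι → List Bool → Prop) : Prop :=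
  ∃ c : Prog, c.QueryFree ∧ SolvesInPolyTime (fun _ => []) c inp R

/-- A promise language. -/
structure PromiseProblem where
  accept : Set (List Bool)
  reject : Set (List Bool)

/-- The class of the promise languages that are decided in polynomial time with oracle access to
`O`. -/
def PolyTimeClass (O : List Bool → List Bool) : Set PromiseProblem :=
  {X | ∃ c : Prog, SolvesInPolyTime O c
    (fun w : {w : List Bool // w ∈ X.accept ∪ X.reject} => w.1)
    (fun w out => (w.1 ∈ X.accept → out = [true]) ∧ (w.1 ∈ X.reject → out = [false]))}

/-! ### Encodings by bit strings -/

/-- Self-delimiting form of a bit string: each bit is preceded by a `1`, and a `0` ends it. -/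
def block : List Bool → List Bool
  | [] => [false]
  | a :: w => true :: a :: block w

/-- A finite sequence of bit strings as one bit string. -/
def encList (ws : List (List Bool)) : List Bool := ws.flatMap block

/-- Binary notation of a natural number, least significant bit first. -/
def encNat (n : ℕ) : List Bool := n.bits

/-- An integer as its sign followed by the binary notation of its absolute value. -/
def encInt (z : ℤ) : List Bool := decide (z < 0) :: encNat z.natAbs

/-- Unary notation. -/
def encUnary (n : ℕ) : List Bool := List.replicate n true

theorem block_append_inj : ∀ {v w x y : List Bool}, block v ++ x = block w ++ y → v = w ∧ x = y
  | [], [], x, y, h => by simpa [block] using h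
  | [], _ :: _, x, y, h => by simp [block] at h
  | _ :: _, [], x, y, h => by simp [block] at h
  | a :: v, a' :: w, x, y, h => by
      simp only [block, List.cons_append, List.cons.injEq, true_and] at h
      obtain ⟨h1, h2⟩ := block_append_inj h.2
      exact ⟨by rw [h.1, h1], h2⟩

theorem block_ne_nil (w : List Bool) : block w ≠ [] := by cases w <;> simp [block]

theorem encList_injective : Function.Injective encList := by
  intro u
  induction u with
  | nil =>
      intro v h
      cases v with
      | nil => rfl
      | cons b v => exact absurd h.symm (by simp [encList, block_ne_nil])
  | cons a u ih =>
      intro v h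
      cases v with
      | nil => exact absurd h (by simp [encList, block_ne_nil])
      | cons b v =>
          simp only [encList, List.flatMap_cons] at h
          obtain ⟨h1, h2⟩ := block_append_inj h
          rw [h1, ih h2]

/-! ### Promise constraint satisfaction problems -/

/-- A finite promise template over the promise domain `(D, E, φ)`: finitely many pairs of
relations `P i ⊆ D ^ ar i` and `Q i ⊆ E ^ ar i` such that `φ` is a homomorphism from the `P i` to
the `Q i`. -/
structure PromiseTemplate (D E : Type*) (φ : D → E) where
  /-- The number of relations. -/
  size : ℕ
  ar : Fin size → ℕ
  P : (i : Fin size) → Set (Fin (ar i) → D)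
  Q : (i : Fin size) → Set (Fin (ar i) → E)
  hom : ∀ i, ∀ x ∈ P i, (fun k => φ (x k)) ∈ Q i

/-- A conjunctive formula over the signature `ar`: the number of variables and the list of the
clauses, each given by a relation symbol `i` and a tuple of `ar i` variables. -/
structure Formula {s : ℕ} (ar : Fin s → ℕ) where
  numVars : ℕ
  clauses : List (Σ i : Fin s, Fin (ar i) → Fin numVars)

/-- The formula is satisfiable when its relation symbols are read as the relations `R i`. -/
def Formula.Satisfiable {s : ℕ} {ar : Fin s → ℕ} (Ψ : Formula ar) {D : Type*}
    (R : (i : Fin s) → Set (Fin (ar i) → D)) : Prop :=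
  ∃ x : Fin Ψ.numVars → D, ∀ cl ∈ Ψ.clauses, (fun k => x (cl.2 k)) ∈ R cl.1

/-- The formula as a bit string. -/
def Formula.enc {s : ℕ} {ar : Fin s → ℕ} (Ψ : Formula ar) : List Bool :=
  encList (encUnary Ψ.numVars ::
    Ψ.clauses.map fun cl =>
      encList (encNat cl.1 :: List.ofFn fun k => encNat (cl.2 k)))

namespace PromiseTemplate

variable {D E : Type*} {φ : D → E}

/-- The promise decision problem of the template: accept the formulas that are satisfiable with
the relations `P i`, reject the formulas that are not satisfiable with the relations `Q i`. -/
def PCSP (Γ : PromiseTemplate D E φ) : PromiseProblem where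
  accept := {w | ∃ Ψ : Formula Γ.ar, w = Ψ.enc ∧ Ψ.Satisfiable Γ.P}
  reject := {w | ∃ Ψ : Formula Γ.ar, w = Ψ.enc ∧ ¬ Ψ.Satisfiable Γ.Q}

/-- `f : D ^ L → E` is a polymorphism: applied coordinatewise to any `L` elements of `P i`, it
gives an element of `Q i`. -/
def IsPolymorphism (Γ : PromiseTemplate D E φ) {L : ℕ} (f : (Fin L → D) → E) : Prop :=
  0 < L ∧ ∀ i, ∀ X : Fin L → Fin (Γ.ar i) → D, (∀ l, X l ∈ Γ.P i) →
    (fun k => f fun l => X l k) ∈ Γ.Q i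

end PromiseTemplate

/-! ### LP-solvable rings -/

/-- A representation of the elements of a subring of `ℝ` by bit strings. Every element has at
least one representation, and it may have several. -/
structure RingRep (A : Subring ℝ) where
  dec : List Bool → Option A
  surj : ∀ a : A, ∃ w, dec w = some a

namespace RingRep

variable {A : Subring ℝ}

/-- The bit strings that represent an element. -/
def Code (ρ : RingRep A) : Type := {w : List Bool // (ρ.dec w).isSome}

/-- The number of bits of a representation. -/
def Code.size {ρ : RingRep A} (u : ρ.Code) : ℕ := u.1.length

/-- The element that is represented. -/
def Code.val {ρ : RingRep A} (u : ρ.Code) : A := (ρ.dec u.1).get u.2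

/-- The ring operation `op` is computed on representations in polynomial time, and the size of the
result is at most `C` times the sum of the sizes of the arguments. -/
def ComputesOp (ρ : RingRep A) (C : ℕ) (op : A → A → A) : Prop :=
  PolyTimeSolvable (fun q : ρ.Code × ρ.Code => encList [q.1.1, q.2.1])
    (fun q out => ρ.dec out = some (op q.1.val q.2.val) ∧
      out.length ≤ C * (q.1.size + q.2.size))

open Classical in
/-- The relation `rel` is decided on representations in polynomial time. -/
def DecidesRel (ρ : RingRep A) (rel : A → A → Prop) : Prop :=
  PolyTimeSolvable (fun q : ρ.Code × ρ.Code => encList [q.1.1, q.2.1])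
    (fun q out => out = [decide (rel q.1.val q.2.val)])

/-- With this representation, `A` is an efficiently computable subring of `ℝ`. -/
structure IsEfficient (ρ : RingRep A) : Prop where
  /-- A representation of an integer `n`, of size polynomial in `log (|n| + 1)`, can be computed in
  polynomial time from the binary notation of `n`. -/
  int : ∃ p : Polynomial ℕ, PolyTimeSolvable encInt
    (fun n out => ρ.dec out = some (n : A) ∧ out.length ≤ p.eval (Nat.size n.natAbs))
  /-- Positive elements are neither too large nor too small. -/
  bounds : ∃ p : Polynomial ℕ, ∀ u : ρ.Code, 0 < (u.val : ℝ) →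
    ((2 : ℝ) ^ p.eval u.size)⁻¹ < (u.val : ℝ) ∧ (u.val : ℝ) < 2 ^ p.eval u.size
  arith : ∃ C : ℕ, 0 < C ∧ ρ.ComputesOp C (fun a a' => a + a') ∧
    ρ.ComputesOp C (fun a a' => a - a') ∧ ρ.ComputesOp C (fun a a' => a * a')
  eq : ρ.DecidesRel fun a a' => a = a'
  lt : ρ.DecidesRel fun a a' => (a : ℝ) < (a' : ℝ)

end RingRep

/-- A system of linear inequalities `mat * x ≤ rhs` with integer coefficients. -/
structure LPSystem where
  numRows : ℕ
  numVars : ℕ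
  mat : Matrix (Fin numRows) (Fin numVars) ℤ
  rhs : Fin numRows → ℤ

/-- `x` satisfies all the inequalities. -/
def LPSystem.Feasible (Λ : LPSystem) (x : Fin Λ.numVars → ℝ) : Prop :=
  ∀ i, ∑ j, (Λ.mat i j : ℝ) * x j ≤ (Λ.rhs i : ℝ)

/-- The system as a bit string: the number of variables, in unary, and the rows, each of them
listing its coefficients and its right-hand side. The length of this string is, up to a constant
factor, the number of rows plus the number of variables plus the number of bits of all the
entries. -/
def LPSystem.enc (Λ : LPSystem) : List Bool :=
  encList [encUnary Λ.numVars, encList (List.ofFn fun i =>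
    encList ((List.ofFn fun j => encInt (Λ.mat i j)) ++ [encInt (Λ.rhs i)]))]

/-- With the representation `ρ`, the ring `A` is LP-solvable: it is efficiently computable, and
there is a polynomial time algorithm that outputs (representations of the coordinates of) a
solution in `A` of a given system of linear inequalities with integer coefficients, or reports
that the system has no solution in `A`. -/
def RingRep.IsLPSolvable {A : Subring ℝ} (ρ : RingRep A) : Prop :=
  ρ.IsEfficient ∧ PolyTimeSolvable LPSystem.enc (fun Λ out =>
    (∃ u : Fin Λ.numVars → ρ.Code, Λ.Feasible (fun j => ((u j).val : ℝ)) ∧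
      out = true :: encList (List.ofFn fun j => (u j).1)) ∨
    ((¬ ∃ x : Fin Λ.numVars → A, Λ.Feasible fun j => (x j : ℝ)) ∧ out = [false]))

/-! ### Open partitions and regional-periodic polymorphisms -/

section Regions

variable {b : ℕ}

/-- The set `(A_1 × ⋯ × A_b) ∩ [0, 1]^b`. -/
def cube (A : Fin b → Subring ℝ) : Set (Fin b → ℝ) :=
  {x | ∀ j, x j ∈ A j ∧ 0 ≤ x j ∧ x j ≤ 1}

/-- `Part` is an open partition: all its fibres are relatively open. -/
def IsOpenPartition {A : Fin b → Subring ℝ} {S : Type*} (Part : cube A → S) : Prop :=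
  ∀ x : cube A, ∃ ε > 0, ∀ y : cube A, dist (y : Fin b → ℝ) x < ε → Part y = Part x

open Classical in
/-- The extension of an open partition to points `x` of `[0, 1]^b` outside of `cube A`: its value
is `k` if `Part` is constantly `k` near `x`, and it is undefined (`none`) if there is no such
`k`. -/
noncomputable def extPart {A : Fin b → Subring ℝ} {S : Type*} (Part : cube A → S)
    (x : Fin b → ℝ) : Option S :=
  if h : ∃ k : S, ∃ ε > 0, ∀ y : cube A, dist x (y : Fin b → ℝ) < ε → Part y = k then
    some h.choose
  else none

/-- A partition `(B_1, …, B_b)` of the coordinates is given by the map `blk` that sends each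
coordinate to the index of its block. This is the size of the block `B_j`. -/
def blockSize {L : ℕ} (blk : Fin L → Fin b) (j : Fin b) : ℕ :=
  (Finset.univ.filter fun l => blk l = j).card

/-- The Hamming weight of `x` in the block `B_j`. -/
def ham {L : ℕ} (blk : Fin L → Fin b) (x : Fin L → Bool) (j : Fin b) : ℕ :=
  (Finset.univ.filter fun l => blk l = j ∧ x l = true).card

theorem ham_le {L : ℕ} (blk : Fin L → Fin b) (x : Fin L → Bool) (j : Fin b) :
    ham blk x j ≤ blockSize blk j :=
  Finset.card_le_card fun l hl => by
    simp only [Finset.mem_filter, Finset.mem_univ, true_and] at hl ⊢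
    exact hl.1

/-- The blocks are nonempty, and the extended partition is defined at all the points
`(c_1 / |B_1|, …, c_b / |B_b|)` with `c_j ∈ {0, …, |B_j|}`. -/
structure Admissible {A : Fin b → Subring ℝ} {S : Type*} (Part : cube A → S) {L : ℕ}
    (blk : Fin L → Fin b) : Prop where
  pos : ∀ j, 0 < blockSize blk j
  defined : ∀ c : Fin b → ℕ, (∀ j, c j ≤ blockSize blk j) →
    (extPart Part fun j => (c j : ℝ) / (blockSize blk j : ℝ)).isSome

/-- The regional-periodic function: `M_k` of the vector of the block Hamming weights modulo `J_k`,
where `k` is the region of the vector of the relative block Hamming weights. -/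
noncomputable def regPer {A : Fin b → Subring ℝ} {S E : Type*} (Part : cube A → S)
    (J : S → Ideal (Fin b → ℤ)) (M : (k : S) → ((Fin b → ℤ) ⧸ J k) → E)
    {L : ℕ} (blk : Fin L → Fin b) (hblk : Admissible Part blk) (x : Fin L → Bool) : E :=
  let k : S := (extPart Part fun j => (ham blk x j : ℝ) / (blockSize blk j : ℝ)).get
    (hblk.defined (ham blk x) (ham_le blk x))
  M k (Ideal.Quotient.mk (J k) fun j => (ham blk x j : ℤ))

open Classical in
/-- The oracle for `Part`: a query consists of representations of the coordinates of a point of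
`cube A`, and the answer is the index of its region. The answer to all other bit strings is the
default index `0`. -/
noncomputable def partOracle {A : Fin b → Subring ℝ} (ρ : (j : Fin b) → RingRep (A j)) {s : ℕ}
    (Part : cube A → Fin s) (w : List Bool) : List Bool :=
  if h : ∃ x : cube A, ∃ u : (j : Fin b) → (ρ j).Code,
      (∀ j, ((u j).val : ℝ) = x.1 j) ∧ w = encList (List.ofFn fun j => (u j).1) then
    encNat (Part h.choose)
  else encNat 0

/-- The answers of the oracle do not depend on a choice. -/
theorem partOracle_query {A : Fin b → Subring ℝ} (ρ : (j : Fin b) → RingRep (A j)) {s : ℕ}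
    (Part : cube A → Fin s) (x : cube A) (u : (j : Fin b) → (ρ j).Code)
    (hu : ∀ j, ((u j).val : ℝ) = x.1 j) :
    partOracle ρ Part (encList (List.ofFn fun j => (u j).1)) = encNat (Part x) := by
  have h : ∃ x : cube A, ∃ u' : (j : Fin b) → (ρ j).Code, (∀ j, ((u' j).val : ℝ) = x.1 j) ∧
      encList (List.ofFn fun j => (u j).1) = encList (List.ofFn fun j => (u' j).1) :=
    ⟨x, u, hu, rfl⟩
  rw [partOracle, dif_pos h]
  obtain ⟨u', hu', he⟩ := h.choose_spec
  have he' := List.ofFn_injective (encList_injective he)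
  have : h.choose = x := by
    apply Subtype.ext
    funext j
    rw [← hu', ← hu]
    have : u j = u' j := Subtype.ext (congrFun he' j)
    rw [this]
  rw [this]

end Regions

end PromiseCSP

open PromiseCSP

/-!
A formula has a linear relaxation over any ring `R`: each clause carries weights in `R` of the
tuples of its relation `P i`, of total weight `1`, and the weight of the tuples with a `1` at a
position depends only on the variable there. Let `m > 0` kill all the quotients `ℤ ^ b / J k`. The
algorithm accepts if the relaxation has nonnegative solutions over all the rings `A j`, found by
linear programming, and a solution over `ℤ / m`, found by elimination. A satisfying assignment over
`{0, 1}` gives solutions over every ring.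

Conversely, let `x v` be the point of the cube with the values of the variable `v` in the solutions
over the `A j`. Given a polymorphism with large blocks, deal out to the coordinates of the block
`B j` tuples of a clause, about `|B j|` times the weight over `A j` copies of each, with the number
of copies congruent modulo `m` to `|B j|` times the weight modulo `m`. The relative Hamming weights
of the rows are then close to `x v`, hence in its region `k`, and their residues modulo `m`, hence
modulo `J k`, depend only on `v`. The polymorphism therefore maps each row to a value that depends
only on `v`, and these values satisfy the clause over `E`. No query to the oracle is needed, since
the regions enter only in this argument and not in the test.
-/

namespace PromiseCSP

/-! ### Rounding with prescribed residues -/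

section Rounding

variable {τ : Type*} {m : ℕ} [NeZero m]

theorem exists_int_ge_cast_eq (x : ℝ) (r : ZMod m) :
    ∃ d : ℤ, x ≤ d ∧ d < x + m ∧ (d : ZMod m) = r := by
  have hm : (0 : ℝ) < m := Nat.cast_pos.2 (NeZero.pos m)
  obtain ⟨z, ⟨hle, hlt⟩, -⟩ := existsUnique_add_zsmul_mem_Ico hm (r.val : ℝ) x
  refine ⟨r.val + z * m, ?_, ?_, ?_⟩
  · simpa using hle
  · simpa using hlt
  · simp

/-- All entries except the one at `p₀` are rounded up independently; the entry at `p₀` makes up for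
the change of the sum, and then has the right residue because the sums agree modulo `m`. -/
theorem exists_int_rounding {T : Finset τ} {p₀ : τ} (hp₀ : p₀ ∈ T) {x : τ → ℝ} {r : τ → ZMod m}
    {n : ℤ} (hx : ∑ p ∈ T, x p = n) (hr : ∑ p ∈ T, r p = n) :
    ∃ d : τ → ℤ, ∑ p ∈ T, d p = n ∧ (∀ p ∈ T, (d p : ZMod m) = r p) ∧
      (∀ p ∈ T, |d p - x p| ≤ T.card * m) ∧ ∀ p ∈ T, p ≠ p₀ → x p ≤ d p := by
  classical
  choose d hd_le hd_lt hd_cast using fun p => exists_int_ge_cast_eq (x p) (r p)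
  set d₀ : ℤ := n - ∑ p ∈ T.erase p₀, d p with hd₀
  have hd₀_sub : (d₀ : ℝ) - x p₀ = -∑ p ∈ T.erase p₀, (d p - x p) := by
    rw [Finset.sum_sub_distrib, hd₀]
    push_cast
    linear_combination -hx - Finset.add_sum_erase T x hp₀
  have hd₀_abs : |d₀ - x p₀| ≤ T.card * m := by
    rw [hd₀_sub, abs_neg, ← nsmul_eq_mul]
    refine (Finset.abs_sum_le_sum_abs _ _).trans ((Finset.sum_le_card_nsmul _ _ (m : ℝ)
      fun p _ => ?_).trans (nsmul_le_nsmul_left (Nat.cast_nonneg m) Finset.card_erase_le))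
    rw [abs_of_nonneg (sub_nonneg.2 (hd_le p))]
    linarith [hd_lt p]
  have hd₀_cast : (d₀ : ZMod m) = r p₀ := by
    rw [hd₀]
    push_cast
    rw [← hr, ← Finset.add_sum_erase T r hp₀, Finset.sum_congr rfl fun p _ => hd_cast p]
    ring
  have hcard : (1 : ℝ) ≤ T.card := Nat.one_le_cast.2 (Finset.card_pos.2 ⟨p₀, hp₀⟩)
  refine ⟨Function.update d p₀ d₀, ?_, fun p _ => ?_, fun p _ => ?_, fun p _ hp => ?_⟩
  · rw [← Finset.add_sum_erase T _ hp₀, Function.update_self,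
      Finset.sum_congr rfl fun p hp => Function.update_of_ne (Finset.ne_of_mem_erase hp) _ _, hd₀]
    ring
  · rcases eq_or_ne p p₀ with rfl | hp
    · rwa [Function.update_self]
    · rw [Function.update_of_ne hp, hd_cast]
  · rcases eq_or_ne p p₀ with rfl | hp
    · rwa [Function.update_self]
    · rw [Function.update_of_ne hp, abs_of_nonneg (sub_nonneg.2 (hd_le p))]
      nlinarith [hd_lt p, (Nat.cast_nonneg m : (0 : ℝ) ≤ m)]
  · rw [Function.update_of_ne hp]
    exact hd_le p

theorem exists_nat_rounding {T : Finset τ} {x : τ → ℝ} {r : τ → ZMod m} {n : ℕ}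
    (hx₀ : ∀ p ∈ T, 0 ≤ x p) (hx : ∑ p ∈ T, x p = n) (hr : ∑ p ∈ T, r p = n)
    (hn : T.card ^ 2 * m ≤ n) :
    ∃ c : τ → ℕ, ∑ p ∈ T, c p = n ∧ (∀ p ∈ T, (c p : ZMod m) = r p) ∧
      ∀ p ∈ T, |c p - x p| ≤ T.card * m := by
  rcases T.eq_empty_or_nonempty with rfl | hT
  · exact ⟨0, by simpa [eq_comm] using hx, by simp, by simp⟩
  obtain ⟨p₀, hp₀, hlarge⟩ : ∃ p ∈ T, (T.card * m : ℝ) ≤ x p := by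
    refine Finset.exists_le_of_sum_le hT ?_
    rw [hx, Finset.sum_const, nsmul_eq_mul, ← mul_assoc, ← sq]
    exact_mod_cast hn
  obtain ⟨d, hd_sum, hd_cast, hd_abs, hd_le⟩ := exists_int_rounding (n := n) hp₀
    (by simpa using hx) (by simpa using hr)
  have hd_toNat : ∀ p ∈ T, ((d p).toNat : ℤ) = d p := fun p hp => by
    refine Int.toNat_of_nonneg ?_
    suffices (0 : ℝ) ≤ d p by exact_mod_cast this
    rcases eq_or_ne p p₀ with rfl | hne
    · linarith [(abs_le.1 (hd_abs p hp)).1]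
    · exact (hx₀ p hp).trans (hd_le p hp hne)
  refine ⟨fun p => (d p).toNat, ?_, fun p hp => ?_, fun p hp => ?_⟩
  · zify
    rw [Finset.sum_congr rfl hd_toNat, hd_sum]
  · rw [← hd_cast p hp, ← Int.cast_natCast, hd_toNat p hp]
  · rw [← Int.cast_natCast, hd_toNat p hp]
    exact hd_abs p hp

end Rounding

theorem exists_map_card_fiber_eq {ι τ : Type*} [Fintype ι] [DecidableEq τ] {T : Finset τ}
    {c : τ → ℕ} (h : ∑ p ∈ T, c p = Fintype.card ι) :
    ∃ X : ι → τ, (∀ l, X l ∈ T) ∧ ∀ p ∈ T, Fintype.card {l // X l = p} = c p := by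
  have hcard : Fintype.card ι = Fintype.card (Σ p : T, Fin (c p)) := by
    simp only [Fintype.card_sigma, Fintype.card_fin]
    rw [Finset.sum_coe_sort T c, h]
  let e := Fintype.equivOfCardEq hcard
  refine ⟨fun l => (e l).1, fun l => (e l).1.2, fun p hp => ?_⟩
  rw [← Fintype.card_fin (c p)]
  refine Fintype.card_congr ((e.subtypeEquiv fun l => ?_).trans
    (Equiv.sigmaSubtype (β := fun p : T => Fin (c p)) ⟨p, hp⟩))
  rw [Subtype.ext_iff]

theorem exists_map_card_block_fiber_eq {b L : ℕ} {τ : Type*} [DecidableEq τ] (blk : Fin L → Fin b)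
    {T : Finset τ} {c : Fin b → τ → ℕ} (h : ∀ j, ∑ p ∈ T, c j p = blockSize blk j) :
    ∃ X : Fin L → τ, (∀ l, X l ∈ T) ∧
      ∀ j, ∀ p ∈ T, (Finset.univ.filter fun l => blk l = j ∧ X l = p).card = c j p := by
  have hblock : ∀ j, ∑ p ∈ T, c j p = Fintype.card {l // blk l = j} := fun j => by
    rw [h, Fintype.card_subtype, blockSize]
  choose X hXT hX using fun j => exists_map_card_fiber_eq (hblock j)
  refine ⟨fun l => X (blk l) ⟨l, rfl⟩, fun l => hXT _ _, fun j p hp => ?_⟩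
  rw [← hX j p hp, ← Fintype.card_subtype]
  refine Fintype.card_congr ((Equiv.subtypeSubtypeEquivSubtypeExists _ _).trans
    (Equiv.subtypeEquivRight fun l => ?_)).symm
  constructor
  · rintro ⟨rfl, hl⟩
    exact ⟨rfl, hl⟩
  · rintro ⟨rfl, hl⟩
    exact ⟨rfl, hl⟩

theorem ham_eq_sum {b L a : ℕ} {blk : Fin L → Fin b} {T : Finset (Fin a → Bool)}
    {X : Fin L → Fin a → Bool} (hX : ∀ l, X l ∈ T) {c : (Fin a → Bool) → ℕ} {j : Fin b}
    (hc : ∀ p ∈ T, (Finset.univ.filter fun l => blk l = j ∧ X l = p).card = c p) (k : Fin a) :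
    ham blk (fun l => X l k) j = ∑ p ∈ T with p k = true, c p := by
  rw [ham, Finset.card_eq_sum_card_fiberwise (f := X) (t := T.filter fun p => p k = true)]
  · refine Finset.sum_congr rfl fun p hp => ?_
    rw [Finset.mem_filter] at hp
    rw [← hc p hp.1, Finset.filter_filter]
    congr 1
    ext l
    simp only [Finset.mem_filter, Finset.mem_univ, true_and]
    constructor
    · tauto
    · rintro ⟨hl, rfl⟩
      exact ⟨⟨hl, hp.2⟩, rfl⟩
  · intro l hl
    simp only [Finset.coe_filter, Finset.mem_univ, true_and, Set.mem_ofPred_eq] at hl ⊢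
    exact ⟨hX l, hl.2⟩

theorem abs_sum_filter_sub_le {τ : Type*} {T : Finset τ} {x y : τ → ℝ} {B : ℝ} (hB : 0 ≤ B)
    (h : ∀ p ∈ T, |x p - y p| ≤ B) (q : τ → Prop) [DecidablePred q] :
    |∑ p ∈ T with q p, x p - ∑ p ∈ T with q p, y p| ≤ T.card * B := by
  rw [← Finset.sum_sub_distrib, ← nsmul_eq_mul]
  exact (Finset.abs_sum_le_sum_abs _ _).trans ((Finset.sum_le_card_nsmul _ _ _ fun p hp =>
    h p (Finset.mem_of_mem_filter p hp)).trans
      (nsmul_le_nsmul_left hB (Finset.card_filter_le _ _)))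

theorem exists_tuples_ham_near {a b L m : ℕ} [NeZero m] (blk : Fin L → Fin b)
    {T : Finset (Fin a → Bool)} {w : Fin b → (Fin a → Bool) → ℝ} {r : (Fin a → Bool) → ZMod m}
    (hw₀ : ∀ j, ∀ p ∈ T, 0 ≤ w j p) (hw : ∀ j, ∑ p ∈ T, w j p = 1)
    (hr : ∑ p ∈ T, r p = 1) (hsize : ∀ j, T.card ^ 2 * m ≤ blockSize blk j) :
    ∃ X : Fin L → Fin a → Bool, (∀ l, X l ∈ T) ∧ ∀ j k,
      |ham blk (fun l => X l k) j - blockSize blk j * ∑ p ∈ T with p k = true, w j p| ≤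
        ((T.card ^ 2 * m : ℕ) : ℝ) ∧
      (ham blk (fun l => X l k) j : ZMod m) =
        blockSize blk j * ∑ p ∈ T with p k = true, r p := by
  choose c hc_sum hc_cast hc_abs using fun j => exists_nat_rounding (m := m) (T := T)
    (x := fun p => blockSize blk j * w j p) (r := fun p => blockSize blk j * r p)
    (n := blockSize blk j) (fun p hp => mul_nonneg (Nat.cast_nonneg _) (hw₀ j p hp))
    (by rw [← Finset.mul_sum, hw, mul_one]) (by rw [← Finset.mul_sum, hr, mul_one]) (hsize j)
  obtain ⟨X, hXT, hX⟩ := exists_map_card_block_fiber_eq blk hc_sum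
  refine ⟨X, hXT, fun j k => ⟨?_, ?_⟩⟩
  · rw [ham_eq_sum hXT (hX j), Finset.mul_sum]
    push_cast
    refine (abs_sum_filter_sub_le (by positivity) (hc_abs j) _).trans (le_of_eq ?_)
    ring
  · rw [ham_eq_sum hXT (hX j), Finset.mul_sum]
    push_cast
    exact Finset.sum_congr rfl fun p hp => hc_cast j p (Finset.mem_of_mem_filter p hp)

/-! ### Regional-periodic functions -/

section Regions

variable {b : ℕ} {A : Fin b → Subring ℝ} {S : Type*} {Part : cube A → S}

theorem exists_cube_dist_lt (hdense : ∀ j, Dense (A j : Set ℝ)) {z : Fin b → ℝ}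
    (hz : ∀ j, 0 ≤ z j ∧ z j ≤ 1) {δ : ℝ} (hδ : 0 < δ) :
    ∃ y : cube A, dist z (y : Fin b → ℝ) < δ := by
  have hcoord : ∀ j, ∃ a ∈ A j, 0 ≤ a ∧ a ≤ 1 ∧ dist (z j) a < δ := by
    intro j
    obtain ⟨hz₀, hz₁⟩ := hz j
    have hlt : max 0 (z j - δ) < min 1 (z j + δ) :=
      max_lt (lt_min one_pos (by linarith)) (lt_min (by linarith) (by linarith))
    obtain ⟨a, ha, hmem⟩ := (hdense j).exists_between hlt
    simp only [Set.mem_Ioo, max_lt_iff, lt_min_iff] at hmem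
    refine ⟨a, ha, hmem.1.1.le, hmem.2.1.le, ?_⟩
    rw [Real.dist_eq, abs_lt]
    constructor <;> linarith [hmem.1.2, hmem.2.2]
  choose a haA ha₀ ha₁ hdist using hcoord
  exact ⟨⟨a, fun j => ⟨haA j, ha₀ j, ha₁ j⟩⟩, (dist_pi_lt_iff hδ).2 hdist⟩

theorem extPart_eq_some (hdense : ∀ j, Dense (A j : Set ℝ)) {x : cube A} {ε : ℝ}
    (hε : ∀ y : cube A, dist (y : Fin b → ℝ) x < ε → Part y = Part x) {z : Fin b → ℝ}
    (hz : ∀ j, 0 ≤ z j ∧ z j ≤ 1) (hzx : dist z x < ε) : extPart Part z = some (Part x) := by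
  have hnear : ∀ y : cube A, dist z (y : Fin b → ℝ) < ε - dist z x → Part y = Part x :=
    fun y hy => hε y (by linarith [dist_triangle_left (y : Fin b → ℝ) x z])
  have hconst : ∃ k : S, ∃ δ > 0, ∀ y : cube A, dist z (y : Fin b → ℝ) < δ → Part y = k :=
    ⟨Part x, ε - dist z x, sub_pos.2 hzx, hnear⟩
  rw [extPart, dif_pos hconst]
  obtain ⟨δ, hδ, hk⟩ := hconst.choose_spec
  obtain ⟨y, hy⟩ := exists_cube_dist_lt hdense hz (lt_min hδ (sub_pos.2 hzx))
  rw [lt_min_iff] at hy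
  rw [← hk y hy.1, hnear y hy.2]

theorem regPer_eq_of_extPart_eq_some {E : Type*} {J : S → Ideal (Fin b → ℤ)}
    {M : (k : S) → ((Fin b → ℤ) ⧸ J k) → E} {L : ℕ} {blk : Fin L → Fin b}
    (hblk : Admissible Part blk) {x : Fin L → Bool} {k : S}
    (h : extPart Part (fun j => (ham blk x j : ℝ) / (blockSize blk j : ℝ)) = some k) :
    regPer Part J M blk hblk x = M k (Ideal.Quotient.mk (J k) fun j => (ham blk x j : ℤ)) := by
  obtain rfl := Option.get_of_eq_some (hblk.defined _ (ham_le blk x)) h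
  rfl

theorem abs_div_sub_lt {h n x B ε : ℝ} (hn : 0 < n) (h_near : |h - n * x| ≤ B)
    (hε : B / n < ε) : |h / n - x| < ε := by
  have heq : h / n - x = (h - n * x) / n := by field_simp
  rw [heq, abs_div, abs_of_pos hn]
  exact (div_le_div_of_nonneg_right h_near hn.le).trans_lt hε

theorem regPer_eq_of_near (hdense : ∀ j, Dense (A j : Set ℝ)) {E : Type*}
    {J : S → Ideal (Fin b → ℤ)} {M : (k : S) → ((Fin b → ℤ) ⧸ J k) → E} {L : ℕ}
    {blk : Fin L → Fin b} (hblk : Admissible Part blk) {y : Fin L → Bool} {x : cube A} {ε B : ℝ}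
    (hε₀ : 0 < ε) (hε : ∀ y : cube A, dist (y : Fin b → ℝ) x < ε → Part y = Part x)
    (hnear : ∀ j, |ham blk y j - blockSize blk j * x.1 j| ≤ B)
    (hB : ∀ j, B / blockSize blk j < ε) :
    regPer Part J M blk hblk y =
      M (Part x) (Ideal.Quotient.mk _ fun j => (ham blk y j : ℤ)) := by
  have hpos : ∀ j, (0 : ℝ) < blockSize blk j := fun j => Nat.cast_pos.2 (hblk.pos j)
  refine regPer_eq_of_extPart_eq_some hblk (extPart_eq_some hdense hε (fun j => ⟨?_, ?_⟩) ?_)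
  · positivity
  · exact (div_le_one (hpos j)).2 (Nat.cast_le.2 (ham_le blk y j))
  · exact (dist_pi_lt_iff hε₀).2 fun j => by
      rw [Real.dist_eq]
      exact abs_div_sub_lt (hpos j) (hnear j) (hB j)

end Regions

theorem exists_natCast_mem_ideals {S R : Type*} [Finite S] [CommRing R] (J : S → Ideal R)
    (hJ : ∀ k, Finite (R ⧸ J k)) : ∃ m : ℕ, 0 < m ∧ ∀ k, (m : R) ∈ J k := by
  have := Fintype.ofFinite S
  refine ⟨∏ k, Nat.card (R ⧸ J k), Finset.prod_pos fun k _ => Nat.card_pos, fun k => ?_⟩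
  refine (J k).mem_of_dvd (Nat.cast_dvd_cast (Finset.dvd_prod_of_mem _ (Finset.mem_univ k))) ?_
  have := Fintype.ofFinite (R ⧸ J k)
  rw [← Ideal.Quotient.eq_zero_iff_mem, map_natCast, Nat.card_eq_fintype_card,
    Nat.cast_card_eq_zero]

theorem mk_eq_mk_of_forall_cast_eq {ι : Type*} {I : Ideal (ι → ℤ)} {m : ℕ}
    (hm : (m : ι → ℤ) ∈ I) {u v : ι → ℤ} (h : ∀ j, (u j : ZMod m) = v j) :
    Ideal.Quotient.mk I u = Ideal.Quotient.mk I v := by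
  choose q hq using fun j => (ZMod.intCast_eq_intCast_iff_dvd_sub (v j) (u j) m).1 (h j).symm
  rw [Ideal.Quotient.eq]
  have huv : u - v = m * q := funext hq
  exact huv ▸ I.mul_mem_right q hm

theorem exists_ge_forall_div_lt {ι : Type*} [Finite ι] (N : ℕ) {ε : ι → ℝ} (hε : ∀ v, 0 < ε v) :
    ∃ ℓ : ℕ, 0 < ℓ ∧ N ≤ ℓ ∧ ∀ v, (N : ℝ) / ℓ < ε v := by
  have hsmall : ∀ᶠ ℓ : ℕ in Filter.atTop, ∀ v, (N : ℝ) / ℓ < ε v :=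
    Filter.eventually_all.2 fun v =>
      (tendsto_const_div_atTop_nhds_zero_nat (N : ℝ)).eventually_lt_const (hε v)
  exact ((Filter.eventually_gt_atTop 0).and
    ((Filter.eventually_ge_atTop N).and hsmall)).exists

/-! ### The linear relaxation of a formula -/

section Relaxation

variable {E : Type*} {φ : Bool → E} {Γ : PromiseTemplate Bool E φ}

open Classical in
/-- The relation `P i` as a finite set of tuples. -/
noncomputable def PromiseTemplate.tuples (Γ : PromiseTemplate Bool E φ) (i : Fin Γ.size) :
    Finset (Fin (Γ.ar i) → Bool) :=
  Finset.univ.filter (· ∈ Γ.P i)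

theorem PromiseTemplate.mem_tuples {i : Fin Γ.size} {p : Fin (Γ.ar i) → Bool} :
    p ∈ Γ.tuples i ↔ p ∈ Γ.P i := by
  simp [tuples]

/-- The clauses of the formulas in `n` variables over the signature `ar`. -/
abbrev Clause {s : ℕ} (ar : Fin s → ℕ) (n : ℕ) := Σ i : Fin s, Fin (ar i) → Fin n

/-- A solution over the ring `R` of the linear relaxation of the formula with the clauses `cls`:
each clause `cl` carries weights `w cl p` of the tuples `p` of its relation, of total weight `1`,
and the weight of the tuples with a `1` at a position depends only on the variable `v` at this
position; it is `x v`. -/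
structure IsRelaxedSolution {n : ℕ} (cls : List (Clause Γ.ar n)) {R : Type*} [Ring R]
    (w : (cl : Clause Γ.ar n) → (Fin (Γ.ar cl.1) → Bool) → R) (x : Fin n → R) : Prop where
  sum_eq_one : ∀ cl ∈ cls, ∑ p ∈ Γ.tuples cl.1, w cl p = 1
  marginal : ∀ cl ∈ cls, ∀ k, ∑ p ∈ Γ.tuples cl.1 with p k = true, w cl p = x (cl.2 k)

section Clauses

variable {n : ℕ} {cls : List (Clause Γ.ar n)}

theorem isRelaxedSolution_iff {R : Type*} [Ring R]
    {w : (cl : Clause Γ.ar n) → (Fin (Γ.ar cl.1) → Bool) → R} {x : Fin n → R} :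
    IsRelaxedSolution cls w x ↔ ∀ cl ∈ cls, ∑ p ∈ Γ.tuples cl.1, w cl p = 1 ∧
      ∀ k, ∑ p ∈ Γ.tuples cl.1 with p k = true, w cl p = x (cl.2 k) :=
  ⟨fun h cl hcl => ⟨h.sum_eq_one cl hcl, h.marginal cl hcl⟩,
    fun h => ⟨fun cl hcl => (h cl hcl).1, fun cl hcl => (h cl hcl).2⟩⟩

theorem IsRelaxedSolution.map {R R' : Type*} [Ring R] [Ring R']
    {w : (cl : Clause Γ.ar n) → (Fin (Γ.ar cl.1) → Bool) → R} {x : Fin n → R}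
    (h : IsRelaxedSolution cls w x) (f : R →+* R') :
    IsRelaxedSolution cls (fun cl p => f (w cl p)) fun v => f (x v) where
  sum_eq_one cl hcl := by rw [← map_sum, h.sum_eq_one cl hcl, map_one]
  marginal cl hcl k := by rw [← map_sum, h.marginal cl hcl]

theorem IsRelaxedSolution.mem_Icc {R : Type*} [Ring R] [PartialOrder R] [IsOrderedAddMonoid R]
    {w : (cl : Clause Γ.ar n) → (Fin (Γ.ar cl.1) → Bool) → R} {x : Fin n → R}
    (h : IsRelaxedSolution cls w x) {cl : Clause Γ.ar n} (hcl : cl ∈ cls)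
    (hw₀ : ∀ p ∈ Γ.tuples cl.1, 0 ≤ w cl p) (k : Fin (Γ.ar cl.1)) :
    x (cl.2 k) ∈ Set.Icc 0 1 := by
  rw [← h.marginal cl hcl k]
  refine ⟨Finset.sum_nonneg fun p hp => hw₀ p (Finset.mem_of_mem_filter p hp), ?_⟩
  rw [← h.sum_eq_one cl hcl]
  exact Finset.sum_le_sum_of_subset_of_nonneg (Finset.filter_subset _ _) fun p hp _ => hw₀ p hp

theorem isRelaxedSolution_indicator (R : Type*) [Ring R] {x : Fin n → Bool}
    (hx : ∀ cl ∈ cls, (fun k => x (cl.2 k)) ∈ Γ.P cl.1) :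
    IsRelaxedSolution cls (fun cl p => if p = fun k => x (cl.2 k) then (1 : R) else 0)
      fun v => if x v = true then 1 else 0 where
  sum_eq_one cl hcl := by
    rw [Finset.sum_ite_eq', if_pos (PromiseTemplate.mem_tuples.2 (hx cl hcl))]
  marginal cl hcl k := by
    rw [Finset.sum_ite_eq']
    simp only [Finset.mem_filter, PromiseTemplate.mem_tuples, hx cl hcl, true_and]

end Clauses

variable {b : ℕ} {A : Fin b → Subring ℝ} {S : Type*} {Part : cube A → S}
  {J : S → Ideal (Fin b → ℤ)} {M : (k : S) → ((Fin b → ℤ) ⧸ J k) → E}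

theorem satisfiable_of_isRelaxedSolution (hdense : ∀ j, Dense (A j : Set ℝ))
    (hPart : IsOpenPartition Part)
    (hpol : ∀ ℓ : ℕ, 0 < ℓ → ∃ (L : ℕ) (blk : Fin L → Fin b) (hblk : Admissible Part blk),
      (∀ j, ℓ ≤ blockSize blk j) ∧ Γ.IsPolymorphism (regPer Part J M blk hblk))
    {m : ℕ} [NeZero m] (hm : ∀ k, (m : Fin b → ℤ) ∈ J k) (Ψ : Formula Γ.ar)
    {w : (j : Fin b) → (cl : Clause Γ.ar Ψ.numVars) → (Fin (Γ.ar cl.1) → Bool) → ℝ}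
    {x : Fin Ψ.numVars → cube A}
    (hw : ∀ j, IsRelaxedSolution Ψ.clauses (w j) fun v => (x v).1 j)
    (hw₀ : ∀ j, ∀ cl ∈ Ψ.clauses, ∀ p ∈ Γ.tuples cl.1, 0 ≤ w j cl p)
    {r : (cl : Clause Γ.ar Ψ.numVars) → (Fin (Γ.ar cl.1) → Bool) → ZMod m}
    {y : Fin Ψ.numVars → ZMod m}
    (hr : IsRelaxedSolution Ψ.clauses r y) : Ψ.Satisfiable Γ.Q := by
  choose ε hε₀ hε using fun v => hPart (x v)
  obtain ⟨N, hN⟩ : ∃ N : ℕ, ∀ i, (Γ.tuples i).card ^ 2 * m ≤ N :=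
    (Set.finite_range fun i => (Γ.tuples i).card ^ 2 * m).bddAbove.imp fun N hN i => hN ⟨i, rfl⟩
  obtain ⟨ℓ, hℓ₀, hNℓ, hNε⟩ := exists_ge_forall_div_lt N hε₀
  obtain ⟨L, blk, hblk, hsize, -, hP⟩ := hpol ℓ hℓ₀
  refine ⟨fun v => M (Part (x v)) (Ideal.Quotient.mk _ fun j =>
    (blockSize blk j : ℤ) * ((y v).val : ℤ)), fun cl hcl => ?_⟩
  obtain ⟨X, hXT, hX⟩ := exists_tuples_ham_near blk (fun j => hw₀ j cl hcl)
    (fun j => (hw j).sum_eq_one cl hcl) (hr.sum_eq_one cl hcl)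
    fun j => (hN cl.1).trans (hNℓ.trans (hsize j))
  convert hP cl.1 X fun l => PromiseTemplate.mem_tuples.1 (hXT l) using 1
  funext k
  have hnear : ∀ j, |ham blk (fun l => X l k) j - blockSize blk j * (x (cl.2 k)).1 j| ≤ (N : ℝ) :=
    fun j => by
      rw [← (hw j).marginal cl hcl k]
      exact (hX j k).1.trans (Nat.cast_le.2 (hN cl.1))
  have hsmall : ∀ j, (N : ℝ) / blockSize blk j < ε (cl.2 k) := fun j =>
    (div_le_div_of_nonneg_left N.cast_nonneg (Nat.cast_pos.2 hℓ₀)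
      (Nat.cast_le.2 (hsize j))).trans_lt (hNε (cl.2 k))
  rw [regPer_eq_of_near hdense hblk (hε₀ _) (hε (cl.2 k)) hnear hsmall]
  refine congrArg (M _) (mk_eq_mk_of_forall_cast_eq (hm _) fun j => ?_)
  push_cast
  rw [(hX j k).2, hr.marginal cl hcl k, ZMod.natCast_zmod_val]

end Relaxation

/-! ### Elimination modulo `m` -/

theorem exists_unimodular_mul_add_mul_eq_zero {m : ℕ} (a a' : ZMod m) :
    ∃ t : (ZMod m × ZMod m) × ZMod m × ZMod m,
      t.2.1 * a + t.2.2 * a' = 0 ∧ t.1.1 * t.2.2 - t.1.2 * t.2.1 = 1 := by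
  obtain ⟨x, rfl⟩ := ZMod.intCast_surjective a
  obtain ⟨y, rfl⟩ := ZMod.intCast_surjective a'
  obtain ⟨p, q, hx, hy, hpq⟩ := extract_gcd x y
  obtain ⟨u, v, huv⟩ := (gcd_isUnit_iff p q).1 hpq
  generalize gcd x y = g at hx hy
  have huv_cast : (u * p + v * q : ZMod m) = 1 := by
    exact_mod_cast congrArg (Int.cast : ℤ → ZMod m) huv
  refine ⟨((u, v), -q, p), ?_, ?_⟩
  · rw [hx, hy]
    push_cast
    ring
  · linear_combination huv_cast

theorem exists_generator_annihilator {m : ℕ} [NeZero m] (a : ZMod m) :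
    ∃ e : ZMod m, e * a = 0 ∧ ∀ d, e * d = 0 → a ∣ d := by
  obtain ⟨x, rfl⟩ := ZMod.intCast_surjective a
  obtain ⟨p, q, hx, hm, hpq⟩ := extract_gcd x (m : ℤ)
  obtain ⟨u, v, huv⟩ := (gcd_isUnit_iff p q).1 hpq
  generalize gcd x (m : ℤ) = g at hx hm
  have hq : q ≠ 0 := by
    rintro rfl
    exact NeZero.ne m (by simpa using hm)
  have hgq : (g * q : ZMod m) = 0 := by
    have := congrArg (Int.cast : ℤ → ZMod m) hm
    push_cast at this
    rw [← this, ZMod.natCast_self]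
  refine ⟨q, ?_, fun d hd => ?_⟩
  · rw [hx]
    push_cast
    linear_combination (p : ZMod m) * hgq
  · obtain ⟨z, rfl⟩ := ZMod.intCast_surjective d
    have hdvd : (m : ℤ) ∣ q * z := (ZMod.intCast_zmod_eq_zero_iff_dvd _ _).1 (by exact_mod_cast hd)
    rw [hm, mul_comm g q] at hdvd
    obtain ⟨k, rfl⟩ := (mul_dvd_mul_iff_left hq).1 hdvd
    refine ⟨u * k, ?_⟩
    have huv_cast : (u * p + v * q : ZMod m) = 1 := by
      exact_mod_cast congrArg (Int.cast : ℤ → ZMod m) huv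
    rw [hx]
    push_cast
    linear_combination -(g * k : ZMod m) * huv_cast + (v * k : ZMod m) * hgq

section Rows

variable {R : Type*} [CommRing R]

/-- The value of the linear form with the coefficients `P` at the point `x`. -/
def rowDot (P x : List R) : R := (List.zipWith (· * ·) P x).sum

/-- The linear combination of two rows with the coefficients `u.1` and `u.2`. -/
def rowComb (u : R × R) (P Q : List R) : List R :=
  List.zipWith (fun a a' => u.1 * a + u.2 * a') P Q

theorem length_rowComb {u : R × R} {P Q : List R} (h : P.length = Q.length) :
    (rowComb u P Q).length = P.length := by
  simp [rowComb, h]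

theorem rowDot_cons (a y : R) (P x : List R) : rowDot (a :: P) (y :: x) = a * y + rowDot P x := by
  simp [rowDot]

theorem rowDot_rowComb (u : R × R) {P Q : List R} (x : List R) (h : P.length = Q.length) :
    rowDot (rowComb u P Q) x = u.1 * rowDot P x + u.2 * rowDot Q x := by
  induction P generalizing Q x with
  | nil =>
    obtain rfl : Q = [] := by simpa using h.symm
    simp [rowDot, rowComb]
  | cons a P ih =>
    obtain ⟨a', Q, rfl⟩ := List.exists_cons_of_length_eq_add_one h.symm
    rcases x with _ | ⟨y, x⟩
    · simp [rowDot]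
    · have := ih x (Nat.succ_injective h)
      simp only [rowComb, List.zipWith_cons_cons, rowDot_cons] at this ⊢
      rw [this]
      ring

theorem rowDot_map_mul (u : R) (P x : List R) : rowDot (P.map (u * ·)) x = u * rowDot P x := by
  induction P generalizing x with
  | nil => simp [rowDot]
  | cons a P ih =>
    rcases x with _ | ⟨y, x⟩
    · simp [rowDot]
    · rw [List.map_cons, rowDot_cons, rowDot_cons, ih]
      ring

end Rows

section Elimination

variable {m : ℕ}

/-- The rows of a matrix of determinant `1` that maps the column `(a, a')` to a column with second
entry `0`. -/
noncomputable def bezout (a a' : ZMod m) : (ZMod m × ZMod m) × ZMod m × ZMod m :=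
  (exists_unimodular_mul_add_mul_eq_zero a a').choose

theorem bezout_snd_mul (a a' : ZMod m) : (bezout a a').2.1 * a + (bezout a a').2.2 * a' = 0 :=
  (exists_unimodular_mul_add_mul_eq_zero a a').choose_spec.1

theorem bezout_det (a a' : ZMod m) :
    (bezout a a').1.1 * (bezout a a').2.2 - (bezout a a').1.2 * (bezout a a').2.1 = 1 :=
  (exists_unimodular_mul_add_mul_eq_zero a a').choose_spec.2

/-- One step of the elimination of the first unknown. The state consists of the pivot row and of
the rows, without their first entry, in which the first unknown has been eliminated; the new row
`P` is eliminated against the pivot row. -/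
noncomputable def elimStep (s : List (ZMod m) × List (List (ZMod m))) (P : List (ZMod m)) :
    List (ZMod m) × List (List (ZMod m)) :=
  let t := bezout (s.1.headD 0) (P.headD 0)
  (rowComb t.1 s.1 P, (rowComb t.2 s.1 P).tail :: s.2)

theorem elimStep_length {n : ℕ} {s : List (ZMod m) × List (List (ZMod m))} {P : List (ZMod m)}
    (hs : s.1.length = n + 1 ∧ ∀ Q ∈ s.2, Q.length = n) (hP : P.length = n + 1) :
    (elimStep s P).1.length = n + 1 ∧ ∀ Q ∈ (elimStep s P).2, Q.length = n := by
  simp only [elimStep, List.forall_mem_cons, List.length_tail]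
  rw [length_rowComb (hs.1.trans hP.symm), length_rowComb (hs.1.trans hP.symm)]
  exact ⟨hs.1, by omega, hs.2⟩

theorem rowDot_tail_rowComb_bezout {n : ℕ} {P Q : List (ZMod m)} (hP : P.length = n + 1)
    (hQ : Q.length = n + 1) (y : ZMod m) (x : List (ZMod m)) :
    rowDot (rowComb (bezout (P.headD 0) (Q.headD 0)).2 P Q).tail x =
      rowDot (rowComb (bezout (P.headD 0) (Q.headD 0)).2 P Q) (y :: x) := by
  obtain ⟨a, P, rfl⟩ := List.exists_cons_of_length_eq_add_one hP
  obtain ⟨a', Q, rfl⟩ := List.exists_cons_of_length_eq_add_one hQ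
  simp only [rowComb, List.zipWith_cons_cons, List.tail_cons, rowDot_cons, List.headD_cons]
  rw [bezout_snd_mul, zero_mul, zero_add]

theorem elimStep_solves_iff {n : ℕ} {s : List (ZMod m) × List (List (ZMod m))}
    {P : List (ZMod m)} (hs : s.1.length = n + 1) (hP : P.length = n + 1) (y : ZMod m)
    (x : List (ZMod m)) :
    (rowDot (elimStep s P).1 (y :: x) = 0 ∧ ∀ Q ∈ (elimStep s P).2, rowDot Q x = 0) ↔
      (rowDot s.1 (y :: x) = 0 ∧ ∀ Q ∈ s.2, rowDot Q x = 0) ∧ rowDot P (y :: x) = 0 := by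
  have hdet := bezout_det (s.1.headD 0) (P.headD 0)
  simp only [elimStep, List.forall_mem_cons]
  rw [rowDot_tail_rowComb_bezout hs hP y, rowDot_rowComb _ _ (hs.trans hP.symm),
    rowDot_rowComb _ _ (hs.trans hP.symm)]
  set t := bezout (s.1.headD 0) (P.headD 0)
  constructor
  · rintro ⟨h₁, h₂, hout⟩
    refine ⟨⟨?_, hout⟩, ?_⟩
    · linear_combination t.2.2 * h₁ - t.1.2 * h₂ - rowDot s.1 (y :: x) * hdet
    · linear_combination t.1.1 * h₂ - t.2.1 * h₁ - rowDot P (y :: x) * hdet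
  · rintro ⟨⟨hpiv, hout⟩, hP₀⟩
    simp only [hpiv, hP₀, mul_zero, add_zero, true_and]
    exact hout

theorem foldl_elimStep_length {n : ℕ} {rows : List (List (ZMod m))}
    {s : List (ZMod m) × List (List (ZMod m))}
    (hs : s.1.length = n + 1 ∧ ∀ Q ∈ s.2, Q.length = n) (hrows : ∀ P ∈ rows, P.length = n + 1) :
    (rows.foldl elimStep s).1.length = n + 1 ∧
      ∀ Q ∈ (rows.foldl elimStep s).2, Q.length = n := by
  induction rows generalizing s with
  | nil => exact hs
  | cons P rows ih =>
    rw [List.forall_mem_cons] at hrows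
    exact ih (elimStep_length hs hrows.1) hrows.2

theorem foldl_elimStep_solves_iff {n : ℕ} {rows : List (List (ZMod m))}
    {s : List (ZMod m) × List (List (ZMod m))}
    (hs : s.1.length = n + 1 ∧ ∀ Q ∈ s.2, Q.length = n) (hrows : ∀ P ∈ rows, P.length = n + 1)
    (y : ZMod m) (x : List (ZMod m)) :
    (rowDot (rows.foldl elimStep s).1 (y :: x) = 0 ∧
        ∀ Q ∈ (rows.foldl elimStep s).2, rowDot Q x = 0) ↔
      (rowDot s.1 (y :: x) = 0 ∧ ∀ Q ∈ s.2, rowDot Q x = 0) ∧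
        ∀ P ∈ rows, rowDot P (y :: x) = 0 := by
  induction rows generalizing s with
  | nil => simp
  | cons P rows ih =>
    rw [List.forall_mem_cons] at hrows
    rw [List.foldl_cons, ih (elimStep_length hs hrows.1) hrows.2,
      elimStep_solves_iff hs.1 hrows.1, List.forall_mem_cons, and_assoc]

variable [NeZero m]

/-- A generator of the ideal of the elements `e` with `e * a = 0`. -/
noncomputable def annihilator (a : ZMod m) : ZMod m := (exists_generator_annihilator a).choose

theorem annihilator_mul (a : ZMod m) : annihilator a * a = 0 :=
  (exists_generator_annihilator a).choose_spec.1

theorem dvd_of_annihilator_mul_eq_zero {a d : ZMod m} (h : annihilator a * d = 0) : a ∣ d :=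
  (exists_generator_annihilator a).choose_spec.2 d h

/-- The condition that the pivot row imposes on the remaining unknowns: the multiple of the row by
the annihilator of its first entry, without that entry. -/
noncomputable def projectPivot (P : List (ZMod m)) : List (ZMod m) :=
  (P.map (annihilator (P.headD 0) * ·)).tail

theorem projectPivot_solves_iff {n : ℕ} {P : List (ZMod m)} (hP : P.length = n + 1)
    (x : List (ZMod m)) : rowDot (projectPivot P) x = 0 ↔ ∃ y, rowDot P (y :: x) = 0 := by
  obtain ⟨a, P, rfl⟩ := List.exists_cons_of_length_eq_add_one hP
  simp only [projectPivot, List.headD_cons, List.map_cons, List.tail_cons, rowDot_cons,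
    rowDot_map_mul]
  constructor
  · intro h
    obtain ⟨y, hy⟩ := dvd_of_annihilator_mul_eq_zero h
    exact ⟨-y, by rw [hy]; ring⟩
  · rintro ⟨y, hy⟩
    linear_combination annihilator a * hy - y * annihilator_mul a

/-- Elimination of the first unknown from a system of homogeneous linear equations, given by its
rows. -/
noncomputable def elimFirst : List (List (ZMod m)) → List (List (ZMod m))
  | [] => []
  | P :: rows =>
    let s := (P :: rows).foldl elimStep (P, [])
    projectPivot s.1 :: s.2

theorem length_of_mem_elimFirst {n : ℕ} {rows : List (List (ZMod m))}
    (hrows : ∀ P ∈ rows, P.length = n + 1) : ∀ P ∈ elimFirst rows, P.length = n := by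
  rcases rows with _ | ⟨P, rows⟩
  · simp [elimFirst]
  · obtain ⟨hpiv, hout⟩ := foldl_elimStep_length (s := (P, []))
      ⟨hrows P List.mem_cons_self, by simp⟩ hrows
    refine List.forall_mem_cons.2 ⟨?_, hout⟩
    rw [projectPivot, List.length_tail, List.length_map, hpiv, Nat.add_sub_cancel]

theorem elimFirst_solves_iff {n : ℕ} {rows : List (List (ZMod m))}
    (hrows : ∀ P ∈ rows, P.length = n + 1) (x : List (ZMod m)) :
    (∀ P ∈ elimFirst rows, rowDot P x = 0) ↔ ∃ y, ∀ P ∈ rows, rowDot P (y :: x) = 0 := by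
  rcases rows with _ | ⟨P, rows⟩
  · simp [elimFirst]
  have hs : P.length = n + 1 ∧ ∀ Q ∈ ([] : List (List (ZMod m))), Q.length = n :=
    ⟨hrows P List.mem_cons_self, by simp⟩
  simp only [elimFirst, List.forall_mem_cons (a := projectPivot _)]
  rw [projectPivot_solves_iff (foldl_elimStep_length hs hrows).1, ← exists_and_right]
  refine exists_congr fun y => ?_
  rw [foldl_elimStep_solves_iff hs hrows]
  simp only [List.forall_mem_cons, List.not_mem_nil, false_implies, implies_true, and_true]
  tauto

/-- Elimination of as many unknowns as the list `cols` has entries. -/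
noncomputable def eliminate {κ : Type*} (cols : List κ) (rows : List (List (ZMod m))) :
    List (List (ZMod m)) :=
  cols.foldl (fun r _ => elimFirst r) rows

/-- A last unknown with the value `-1` turns the right-hand sides into coefficients; after the
elimination of all others, each row consists of a right-hand side, which must be `0`. -/
theorem eliminate_eq_zero_iff {κ : Type*} {cols : List κ} {rows : List (List (ZMod m))}
    (hrows : ∀ P ∈ rows, P.length = cols.length + 1) :
    (∀ P ∈ eliminate cols rows, P.headD 0 = 0) ↔
      ∃ x : List (ZMod m), x.length = cols.length ∧ ∀ P ∈ rows, rowDot P (x ++ [-1]) = 0 := by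
  induction cols generalizing rows with
  | nil =>
    have hhead : ∀ P ∈ rows, P.headD 0 = 0 ↔ rowDot P [-1] = 0 := by
      intro P hP
      obtain ⟨a, rfl⟩ := List.length_eq_one_iff.1 (hrows P hP)
      simp [rowDot]
    simp only [List.length_nil, List.length_eq_zero_iff, exists_eq_left, List.nil_append]
    exact forall₂_congr hhead
  | cons c cols ih =>
    rw [eliminate, List.foldl_cons, ← eliminate, ih (length_of_mem_elimFirst hrows)]
    simp only [elimFirst_solves_iff hrows]
    constructor
    · rintro ⟨x, hx, y, hy⟩
      exact ⟨y :: x, by simp [hx], hy⟩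
    · rintro ⟨x, hx, h⟩
      obtain ⟨y, x, rfl⟩ := List.exists_cons_of_length_eq_add_one hx
      exact ⟨x, by simpa using hx, y, h⟩

end Elimination

/-! ### Linear systems with named unknowns -/

/-- Names of the unknowns of a linear system. The name `[]` is reserved for the constant `-1`, so
that constant terms are coefficients as well. -/
abbrev Name := List (List Bool)

/-- A linear equation with coefficients `0`, `1` and `-1`: the sum of the unknowns in the first
list equals the sum of the unknowns in the second list. -/
abbrev LinRow := List Name × List Name

/-- The coefficient of the unknown `γ` in `left - right`, for an equation without repetitions. -/
def coef (r : LinRow) (γ : Name) : ℤ := (if γ ∈ r.1 then 1 else 0) - if γ ∈ r.2 then 1 else 0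

/-- Insertion of a name into a list of names, ignoring the reserved name. -/
def insertName (s : List Name) (γ : Name) : List Name := if γ = [] then s else s.insert γ

/-- The unknowns of a linear system, without the reserved name and without repetitions. -/
def unknowns (rs : List LinRow) : List Name :=
  (rs.flatMap fun r => r.1 ++ r.2).foldl insertName []

/-- `y` satisfies the equations, and takes the value `-1` at the reserved name. -/
def Solves {R : Type*} [Ring R] (rs : List LinRow) (y : Name → R) : Prop :=
  y [] = -1 ∧ ∀ r ∈ rs, (r.1.map y).sum = (r.2.map y).sum

/-- No unknown is repeated on one side of an equation. -/
def Simple (rs : List LinRow) : Prop := ∀ r ∈ rs, r.1.Nodup ∧ r.2.Nodup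

theorem mem_insertName {s : List Name} {γ δ : Name} :
    γ ∈ insertName s δ ↔ γ ∈ s ∨ γ = δ ∧ γ ≠ [] := by
  rw [insertName]
  split_ifs with h
  · rw [h]
    tauto
  · rw [List.mem_insert_iff]
    constructor
    · rintro (rfl | hγ)
      · exact Or.inr ⟨rfl, h⟩
      · exact Or.inl hγ
    · tauto

theorem mem_foldl_insertName {l s : List Name} {γ : Name} :
    γ ∈ l.foldl insertName s ↔ γ ∈ s ∨ γ ∈ l ∧ γ ≠ [] := by
  induction l generalizing s with
  | nil => simp
  | cons δ l ih =>
    rw [List.foldl_cons, ih, mem_insertName, List.mem_cons]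
    tauto

theorem nodup_foldl_insertName {l s : List Name} (hs : s.Nodup) :
    (l.foldl insertName s).Nodup := by
  induction l generalizing s with
  | nil => exact hs
  | cons δ _ ih =>
    refine ih ?_
    rw [insertName]
    split_ifs
    exacts [hs, hs.insert]

theorem nodup_unknowns (rs : List LinRow) : (unknowns rs).Nodup :=
  nodup_foldl_insertName List.nodup_nil

theorem nil_notMem_unknowns (rs : List LinRow) : [] ∉ unknowns rs := by
  simp [unknowns, mem_foldl_insertName]

theorem mem_unknowns {rs : List LinRow} {r : LinRow} (hr : r ∈ rs) {γ : Name}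
    (hγ : γ ∈ r.1 ∨ γ ∈ r.2) (hne : γ ≠ []) : γ ∈ unknowns rs :=
  mem_foldl_insertName.2 (Or.inr ⟨List.mem_flatMap.2 ⟨r, hr, List.mem_append.2 hγ⟩, hne⟩)

theorem nodup_unknowns_append_nil (rs : List LinRow) : (unknowns rs ++ [[]]).Nodup :=
  (nodup_unknowns rs).append (List.nodup_singleton _)
    (List.disjoint_singleton.2 (nil_notMem_unknowns rs))

theorem sum_map_indicator_mul {κ R : Type*} [DecidableEq κ] [Semiring R] {cols l : List κ}
    (hcols : cols.Nodup) (hl : l.Nodup) (hsub : l ⊆ cols) (y : κ → R) :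
    (cols.map fun γ => (if γ ∈ l then 1 else 0) * y γ).sum = (l.map y).sum := by
  rw [← List.sum_toFinset _ hcols, ← List.sum_toFinset _ hl]
  simp only [ite_mul, one_mul, zero_mul]
  rw [← Finset.sum_filter]
  congr 1
  ext γ
  simp only [Finset.mem_filter, List.mem_toFinset]
  exact ⟨fun h => h.2, fun h => ⟨hsub h, h⟩⟩

theorem sum_map_coef_mul {R : Type*} [CommRing R] {cols : List Name} {r : LinRow}
    (hcols : cols.Nodup) (hr : r.1.Nodup ∧ r.2.Nodup) (hsub : ∀ γ, γ ∈ r.1 ∨ γ ∈ r.2 → γ ∈ cols)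
    (y : Name → R) :
    (cols.map fun γ => (coef r γ : R) * y γ).sum = (r.1.map y).sum - (r.2.map y).sum := by
  rw [← sum_map_indicator_mul hcols hr.1 (fun γ h => hsub γ (Or.inl h)) y,
    ← sum_map_indicator_mul hcols hr.2 (fun γ h => hsub γ (Or.inr h)) y]
  refine Eq.trans ?_ (Multiset.sum_map_sub (m := (cols : Multiset Name)))
  rw [Multiset.map_coe, Multiset.sum_coe]
  congr 1
  refine List.map_congr_left fun γ _ => ?_
  rw [coef, ← sub_mul]
  push_cast
  congr!

/-- The difference of the two sides of `r` as a linear form in the unknowns `cols`, with the value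
`-1` at the reserved name. -/
def rowValue {R : Type*} [Ring R] (cols : List Name) (r : LinRow) (y : Name → R) : R :=
  (cols.map fun γ => (coef r γ : R) * y γ).sum - coef r []

theorem rowValue_unknowns {R : Type*} [CommRing R] {rs : List LinRow} (hrs : Simple rs)
    {r : LinRow} (hr : r ∈ rs) {y : Name → R} (hy : y [] = -1) :
    rowValue (unknowns rs) r y = (r.1.map y).sum - (r.2.map y).sum := by
  rw [← sum_map_coef_mul (nodup_unknowns_append_nil rs) (hrs r hr) fun γ hγ => ?_]
  · simp [rowValue, hy, sub_eq_add_neg]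
  · rw [List.mem_append, List.mem_singleton, or_iff_not_imp_right]
    exact mem_unknowns hr hγ

theorem exists_map_eq_of_nodup {κ R : Type*} {cols : List κ} (hcols : cols.Nodup)
    {x : List R} (hx : x.length = cols.length) (d : R) :
    ∃ y : κ → R, cols.map y = x ∧ ∀ γ, γ ∉ cols → y γ = d := by
  classical
  refine ⟨fun γ => x.getD (cols.idxOf γ) d, List.ext_getElem (by simp [hx]) fun i hi _ => ?_,
    fun γ hγ => ?_⟩
  · rw [List.getElem_map, hcols.idxOf_getElem, List.getD_eq_getElem]
  · simp only [List.idxOf_of_notMem hγ, ← hx]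
    exact List.getD_eq_default _ _ le_rfl

/-- The matrix of the system modulo `m`; its last column contains the right-hand sides. -/
def augmentedMatrix (m : ℕ) (rs : List LinRow) : List (List (ZMod m)) :=
  rs.map fun r => (unknowns rs ++ [[]]).map fun γ => (coef r γ : ZMod m)

theorem augmentedMatrix_solves_iff {m : ℕ} {rs : List LinRow} (hrs : Simple rs)
    {y : Name → ZMod m} (hy : y [] = -1) :
    (∀ P ∈ augmentedMatrix m rs, rowDot P ((unknowns rs).map y ++ [-1]) = 0) ↔ Solves rs y := by
  have hcols : (unknowns rs).map y ++ [-1] = (unknowns rs ++ [[]]).map y := by simp [hy]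
  rw [Solves, and_iff_right hy, augmentedMatrix, List.forall_mem_map, hcols]
  refine forall₂_congr fun r hr => ?_
  rw [← sub_eq_zero (b := (r.2.map y).sum), ← rowValue_unknowns hrs hr hy, rowDot,
    List.zipWith_map, List.zipWith_self]
  simp [rowValue, hy, sub_eq_add_neg]

theorem exists_solves_zmod_iff {m : ℕ} [NeZero m] {rs : List LinRow} (hrs : Simple rs) :
    (∀ P ∈ eliminate (unknowns rs) (augmentedMatrix m rs), P.headD 0 = 0) ↔
      ∃ y : Name → ZMod m, Solves rs y := by
  rw [eliminate_eq_zero_iff fun P hP => by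
    obtain ⟨r, -, rfl⟩ := List.mem_map.1 hP
    simp]
  constructor
  · rintro ⟨x, hx, h⟩
    obtain ⟨y, rfl, hy⟩ := exists_map_eq_of_nodup (nodup_unknowns rs) hx (-1)
    exact ⟨y, (augmentedMatrix_solves_iff hrs (hy _ (nil_notMem_unknowns rs))).1 h⟩
  · rintro ⟨y, hy⟩
    exact ⟨_, by simp, (augmentedMatrix_solves_iff hrs hy.1).2 hy⟩

theorem solves_map_iff {R R' : Type*} [Ring R] [Ring R'] {f : R →+* R'}
    (hf : Function.Injective f) {rs : List LinRow} {y : Name → R} :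
    Solves rs (fun γ => f (y γ)) ↔ Solves rs y := by
  have hsum : ∀ l : List Name, (l.map fun γ => f (y γ)).sum = f (l.map y).sum := fun l => by
    rw [map_list_sum, List.map_map]
    rfl
  simp only [Solves, hsum, hf.eq_iff]
  rw [← map_one f, ← map_neg, hf.eq_iff]

/-! ### Nonnegative solutions and linear programs -/

/-- The linear program has a solution with coordinates in `A`. -/
def LPSystem.FeasibleIn (A : Subring ℝ) (Λ : LPSystem) : Prop :=
  ∃ x : Fin Λ.numVars → A, Λ.Feasible fun j => (x j : ℝ)

/-- The inequalities `left ≤ right` for nonnegative solutions of the equations `rs`: both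
directions of each equation, and `0 ≤ γ` for all unknowns. -/
def lpRows (rs : List LinRow) : List LinRow :=
  rs ++ (rs.map fun r => (r.2, r.1)) ++ (unknowns rs).map fun γ => ([], [γ])

/-- The linear program whose solutions are the nonnegative solutions of the equations `rs`. -/
def lpSystem (rs : List LinRow) : LPSystem where
  numRows := (lpRows rs).length
  numVars := (unknowns rs).length
  mat i j := coef (lpRows rs)[i] (unknowns rs)[j]
  rhs i := coef (lpRows rs)[i] []

theorem rowValue_swap {R : Type*} [CommRing R] (cols : List Name) (r : LinRow) (y : Name → R) :
    rowValue cols (r.2, r.1) y = -rowValue cols r y := by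
  have hcoef : ∀ γ, coef (r.2, r.1) γ = -coef r γ := fun γ => by simp [coef]
  have hneg : (cols.map fun γ => -((coef r γ : R) * y γ)).sum =
      -(cols.map fun γ => (coef r γ : R) * y γ).sum := by
    rw [List.sum_neg, List.map_map]
    rfl
  simp only [rowValue, hcoef, Int.cast_neg, neg_mul, hneg]
  ring

theorem rowValue_nonneg_row {R : Type*} [CommRing R] {cols : List Name} (hcols : cols.Nodup)
    {γ : Name} (hγ : γ ∈ cols) (hne : γ ≠ []) (y : Name → R) :
    rowValue cols ([], [γ]) y = -y γ := by
  rw [rowValue, sum_map_coef_mul hcols (by simp) (by simpa using hγ)]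
  simp [coef, hne.symm]

theorem feasible_lpSystem_iff_rowValue {rs : List LinRow} {y : Name → ℝ} :
    (lpSystem rs).Feasible (fun j => y (unknowns rs)[j]) ↔
      ∀ r ∈ lpRows rs, rowValue (unknowns rs) r y ≤ 0 := by
  simp only [rowValue, sub_nonpos]
  rw [List.forall_mem_iff_getElem, LPSystem.Feasible, Fin.forall_iff]
  refine forall₂_congr fun i hi => ?_
  rw [← Fin.sum_univ_fun_getElem]
  rfl

theorem feasible_lpSystem_iff {rs : List LinRow} (hrs : Simple rs) {y : Name → ℝ}
    (hy : y [] = -1) :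
    (lpSystem rs).Feasible (fun j => y (unknowns rs)[j]) ↔
      Solves rs y ∧ ∀ γ ∈ unknowns rs, 0 ≤ y γ := by
  rw [feasible_lpSystem_iff_rowValue, lpRows, List.forall_mem_append, List.forall_mem_append,
    List.forall_mem_map, List.forall_mem_map, Solves, and_iff_right hy, ← forall₂_and]
  refine and_congr (forall₂_congr fun r hr => ?_) (forall₂_congr fun γ hγ => ?_)
  · rw [rowValue_swap, rowValue_unknowns hrs hr hy, neg_nonpos, sub_nonpos, sub_nonneg,
      ← le_antisymm_iff]
  · rw [rowValue_nonneg_row (nodup_unknowns rs) hγ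
      (ne_of_mem_of_not_mem hγ (nil_notMem_unknowns rs)), neg_nonpos]

theorem feasibleIn_lpSystem_iff {A : Subring ℝ} {rs : List LinRow} (hrs : Simple rs) :
    (lpSystem rs).FeasibleIn A ↔
      ∃ y : Name → A, Solves rs y ∧ ∀ γ ∈ unknowns rs, 0 ≤ (y γ : ℝ) := by
  have hcoe : ∀ y : Name → A, Solves rs (fun γ => (y γ : ℝ)) ↔ Solves rs y := fun y =>
    solves_map_iff (f := A.subtype) Subtype.coe_injective
  simp only [← hcoe]
  constructor
  · rintro ⟨x, hx⟩
    obtain ⟨y, hyx, hy⟩ := exists_map_eq_of_nodup (nodup_unknowns rs) (x := List.ofFn x)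
      List.length_ofFn (-1)
    refine ⟨y, (feasible_lpSystem_iff (y := fun γ => (y γ : ℝ)) hrs
      (by simp [hy _ (nil_notMem_unknowns rs)])).1 ?_⟩
    convert hx using 2 with j
    have h := List.getElem_of_eq hyx (i := j) (by rw [List.length_map]; exact j.2)
    simp only [List.getElem_map, List.getElem_ofFn] at h
    exact congrArg _ h
  · rintro ⟨y, hy⟩
    exact ⟨_, (feasible_lpSystem_iff (y := fun γ => (y γ : ℝ)) hrs hy.1.1).2 hy⟩

/-! ### The linear system of a formula -/

section FormulaRows

theorem encNat_injective : Function.Injective encNat := fun a b h => by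
  refine Nat.digits.injective 2 ?_
  rw [Nat.digits_two_eq_bits, Nat.digits_two_eq_bits]
  exact congrArg _ h

/-- The bit strings that encode a clause in `Formula.enc`, as a name. -/
def clauseName {s n : ℕ} {ar : Fin s → ℕ} (cl : Clause ar n) : Name :=
  encNat cl.1 :: List.ofFn fun k => encNat (cl.2 k)

/-- The name of the weight of the tuple `p` in the clause with the name `c`. The variable `v` has
the name `[encNat v]`, and thus no unknown has two meanings. -/
def weightName (c : Name) {a : ℕ} (p : Fin a → Bool) : Name := List.ofFn p :: c

theorem weightName_injective (c : Name) {a : ℕ} :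
    Function.Injective fun p : Fin a → Bool => weightName c p := fun _ _ h =>
  List.ofFn_injective (List.cons.inj h).1

variable {E : Type*} {φ : Bool → E} (Γ : PromiseTemplate Bool E φ)

/-- The equations of `IsRelaxedSolution` for a clause with the relation symbol `i` and the
name `c`. -/
noncomputable def clauseRowsAt (i : Fin Γ.size) (c : Name) : List LinRow :=
  ((Γ.tuples i).toList.map (fun p => weightName c p) ++ [[]], []) ::
    (List.finRange (Γ.ar i)).map fun k =>
      (((Γ.tuples i).filter fun p => p k = true).toList.map (fun p => weightName c p),
        [[c.getD (k + 1) []]])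

/-- The equations of the clause with the name `c`; the relation symbol is read off the name. -/
noncomputable def clauseRows (c : Name) : List LinRow :=
  (List.finRange Γ.size).flatMap fun i : Fin Γ.size =>
    if c.headD [] = encNat i then clauseRowsAt Γ i c else []

/-- The equations of `IsRelaxedSolution` for a list of names of clauses. -/
noncomputable def formulaRows (cs : List Name) : List LinRow := cs.flatMap (clauseRows Γ)

variable {Γ}

theorem mem_clauseRows {n : ℕ} {cl : Clause Γ.ar n} {r : LinRow} :
    r ∈ clauseRows Γ (clauseName cl) ↔ r ∈ clauseRowsAt Γ cl.1 (clauseName cl) := by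
  have hhead : ∀ i : Fin Γ.size, (clauseName cl).headD [] = encNat i ↔ cl.1 = i := fun i =>
    encNat_injective.eq_iff.trans Fin.ext_iff.symm
  simp only [clauseRows, List.mem_flatMap, List.mem_finRange, true_and, List.mem_ite_nil_right,
    hhead, exists_eq_left']

theorem forall_mem_formulaRows {n : ℕ} {cls : List (Clause Γ.ar n)} {p : LinRow → Prop} :
    (∀ r ∈ formulaRows Γ (cls.map clauseName), p r) ↔
      ∀ cl ∈ cls, ∀ r ∈ clauseRowsAt Γ cl.1 (clauseName cl), p r := by
  simp only [formulaRows, List.forall_mem_flatMap, List.forall_mem_map, mem_clauseRows]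

theorem simple_formulaRows {n : ℕ} (cls : List (Clause Γ.ar n)) :
    Simple (formulaRows Γ (cls.map clauseName)) := by
  rw [Simple, forall_mem_formulaRows]
  intro cl _
  have hnodup : ∀ T : Finset (Fin (Γ.ar cl.1) → Bool),
      (T.toList.map fun p => weightName (clauseName cl) p).Nodup := fun T =>
    T.nodup_toList.map (weightName_injective _)
  rw [clauseRowsAt, List.forall_mem_cons, List.forall_mem_map]
  refine ⟨⟨(hnodup _).append (List.nodup_singleton _) ?_, List.nodup_nil⟩,
    fun k _ => ⟨hnodup _, List.nodup_singleton _⟩⟩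
  simp [weightName]

theorem solves_formulaRows_iff {R : Type*} [Ring R] {n : ℕ} {cls : List (Clause Γ.ar n)}
    {y : Name → R} :
    Solves (formulaRows Γ (cls.map clauseName)) y ↔ y [] = -1 ∧
      IsRelaxedSolution cls (fun cl p => y (weightName (clauseName cl) p))
        fun v => y [encNat v] := by
  rw [Solves, forall_mem_formulaRows, isRelaxedSolution_iff]
  refine and_congr_right fun hy => forall₂_congr fun cl _ => ?_
  rw [clauseRowsAt, List.forall_mem_cons, List.forall_mem_map]
  refine and_congr ?_ ?_
  · rw [List.map_append, List.map_map, List.sum_append]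
    simp only [Function.comp_def, Finset.sum_map_toList]
    simp [hy, ← sub_eq_add_neg, sub_eq_zero]
  · simp only [List.map_map, Function.comp_def, Finset.sum_map_toList]
    simp [clauseName]

theorem weightName_mem_unknowns {n : ℕ} {cls : List (Clause Γ.ar n)} {cl : Clause Γ.ar n}
    (hcl : cl ∈ cls) {p : Fin (Γ.ar cl.1) → Bool} (hp : p ∈ Γ.tuples cl.1) :
    weightName (clauseName cl) p ∈ unknowns (formulaRows Γ (cls.map clauseName)) := by
  refine mem_unknowns (List.mem_flatMap.2 ⟨_, List.mem_map_of_mem hcl,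
    mem_clauseRows.2 List.mem_cons_self⟩) (Or.inl ?_) (List.cons_ne_nil _ _)
  exact List.mem_append_left _ (List.mem_map.2 ⟨p, Finset.mem_toList.2 hp, rfl⟩)

/-- The value of the variable with the name `[v]` in the assignment `x`. -/
def namedValue {n : ℕ} (x : Fin n → Bool) (v : List Bool) : Bool :=
  decide (∃ i : Fin n, encNat i = v ∧ x i = true)

theorem namedValue_encNat {n : ℕ} (x : Fin n → Bool) (i : Fin n) :
    namedValue x (encNat i) = x i := by
  simp [namedValue, encNat_injective.eq_iff, Fin.val_inj]

/-- The solution of the linear system of a formula that is given by a satisfying assignment: in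
each clause, the tuple of the values of its variables has the weight `1`. -/
def assignmentSolution (R : Type*) [Ring R] {n : ℕ} (x : Fin n → Bool) : Name → R
  | [] => -1
  | [v] => if namedValue x v = true then 1 else 0
  | p :: _ :: vs => if p = vs.map (namedValue x) then 1 else 0

theorem assignmentSolution_weightName (R : Type*) [Ring R] {n : ℕ} (x : Fin n → Bool)
    (cl : Clause Γ.ar n) (p : Fin (Γ.ar cl.1) → Bool) :
    assignmentSolution R x (weightName (clauseName cl) p) =
      if p = fun k => x (cl.2 k) then 1 else 0 := by
  have hvalues : (List.ofFn fun k => encNat (cl.2 k)).map (namedValue x) =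
      List.ofFn fun k => x (cl.2 k) := by
    simp only [List.map_ofFn, Function.comp_def, namedValue_encNat]
  simp only [assignmentSolution, weightName, clauseName, hvalues, List.ofFn_injective.eq_iff]

theorem solves_assignmentSolution (R : Type*) [Ring R] {n : ℕ} {cls : List (Clause Γ.ar n)}
    {x : Fin n → Bool} (hx : ∀ cl ∈ cls, (fun k => x (cl.2 k)) ∈ Γ.P cl.1) :
    Solves (formulaRows Γ (cls.map clauseName)) (assignmentSolution R x) := by
  refine solves_formulaRows_iff.2 ⟨rfl, ?_⟩
  simp only [assignmentSolution_weightName]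
  simp only [assignmentSolution, namedValue_encNat]
  exact isRelaxedSolution_indicator R hx

theorem assignmentSolution_nonneg (R : Type*) [Ring R] [PartialOrder R] [ZeroLEOneClass R] {n : ℕ}
    (x : Fin n → Bool) {γ : Name} (hγ : γ ≠ []) : 0 ≤ assignmentSolution R x γ := by
  rcases γ with _ | ⟨p, _ | ⟨v, vs⟩⟩
  · exact absurd rfl hγ
  all_goals
    rw [assignmentSolution]
    split_ifs
    exacts [zero_le_one, le_rfl]

theorem satisfiable_of_solves {b : ℕ} {A : Fin b → Subring ℝ}
    (hdense : ∀ j, Dense (A j : Set ℝ)) {S : Type*} {Part : cube A → S}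
    (hPart : IsOpenPartition Part) {J : S → Ideal (Fin b → ℤ)}
    {M : (k : S) → ((Fin b → ℤ) ⧸ J k) → E}
    (hpol : ∀ ℓ : ℕ, 0 < ℓ → ∃ (L : ℕ) (blk : Fin L → Fin b) (hblk : Admissible Part blk),
      (∀ j, ℓ ≤ blockSize blk j) ∧ Γ.IsPolymorphism (regPer Part J M blk hblk))
    {m : ℕ} [NeZero m] (hm : ∀ k, (m : Fin b → ℤ) ∈ J k) (Ψ : Formula Γ.ar)
    (hA : ∀ j, ∃ y : Name → A j, Solves (formulaRows Γ (Ψ.clauses.map clauseName)) y ∧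
      ∀ γ ∈ unknowns (formulaRows Γ (Ψ.clauses.map clauseName)), 0 ≤ (y γ : ℝ))
    (hm' : ∃ y : Name → ZMod m, Solves (formulaRows Γ (Ψ.clauses.map clauseName)) y) :
    Ψ.Satisfiable Γ.Q := by
  classical
  choose y hy hy₀ using hA
  obtain ⟨z, hz⟩ := hm'
  have hrel := fun j => (solves_formulaRows_iff.1 (hy j)).2.map (A j).subtype
  have hweight : ∀ j, ∀ cl ∈ Ψ.clauses, ∀ p ∈ Γ.tuples cl.1,
      0 ≤ (A j).subtype (y j (weightName (clauseName cl) p)) := fun j cl hcl p hp =>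
    hy₀ j _ (weightName_mem_unknowns hcl hp)
  -- Variables that occur in no clause are not constrained to `[0, 1]`, and get the value `0`.
  let x : Fin Ψ.numVars → cube A := fun v => ⟨fun j =>
    if (y j [encNat v] : ℝ) ∈ Set.Icc 0 1 then y j [encNat v] else 0, fun j => by
      beta_reduce
      split_ifs with h
      exacts [⟨(y j _).2, h⟩, ⟨(A j).zero_mem, le_rfl, zero_le_one⟩]⟩
  refine satisfiable_of_isRelaxedSolution (x := x) hdense hPart hpol hm Ψ (fun j => ?_) hweight
    (solves_formulaRows_iff.1 hz).2
  refine ⟨(hrel j).sum_eq_one, fun cl hcl k => ((hrel j).marginal cl hcl k).trans ?_⟩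
  exact (if_pos ((hrel j).mem_Icc hcl (hweight j cl hcl) k)).symm

end FormulaRows

/-! ### Programs -/

theorem Exec.of_queryFree {O O' : List Bool → List Bool} {c : Prog} {s s' : Store} {t : ℕ}
    (h : Exec O c s s' t) (hc : c.QueryFree) : Exec O' c s s' t := by
  induction h with
  | skip s => exact .skip s
  | push r a s => exact .push r a s
  | pop r s => exact .pop r s
  | query r s => exact hc.elim
  | seq _ _ ih₁ ih₂ => exact .seq (ih₁ hc.1) (ih₂ hc.2)
  | test_empty h _ ih => exact .test_empty h (ih hc.1)
  | test_zero h _ ih => exact .test_zero h (ih hc.2.1)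
  | test_one h _ ih => exact .test_one h (ih hc.2.2)
  | loop_done h => exact .loop_done h
  | loop_step h _ _ ih₁ ih₂ => exact .loop_step h (ih₁ hc) (ih₂ hc)

theorem Exec.length_le {O : List Bool → List Bool} {c : Prog} {s s' : Store} {t : ℕ}
    (h : Exec O c s s' t) (hc : c.QueryFree) (q : ℕ) : (s' q).length ≤ (s q).length + t := by
  induction h with
  | skip s => simp
  | push r a s =>
      by_cases hq : q = r
      · subst hq; simp
      · simp [Function.update_of_ne hq]
  | pop r s =>
      by_cases hq : q = r
      · subst hq; simp; omega
      · simp [Function.update_of_ne hq]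
  | query r s => exact hc.elim
  | seq _ _ ih₁ ih₂ => have := ih₁ hc.1; have := ih₂ hc.2; omega
  | test_empty _ _ ih => have := ih hc.1; omega
  | test_zero _ _ ih => have := ih hc.2.1; omega
  | test_one _ _ ih => have := ih hc.2.2; omega
  | loop_done _ => simp
  | loop_step _ _ _ ih₁ ih₂ => have := ih₁ hc; have := ih₂ hc; omega

/-- A strict upper bound for the indices of the registers that the program mentions. -/
def Prog.bound : Prog → ℕ
  | .skip => 0
  | .push r _ => r + 1
  | .pop r => r + 1
  | .query r => r + 1
  | .seq c d => max c.bound d.bound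
  | .test r c d e => max (r + 1) (max c.bound (max d.bound e.bound))
  | .loop r c => max (r + 1) c.bound

theorem Exec.eq_of_bound_le {O : List Bool → List Bool} {c : Prog} {s s' : Store} {t : ℕ}
    (h : Exec O c s s' t) {q : ℕ} (hq : c.bound ≤ q) : s' q = s q := by
  induction h with
  | skip s => rfl
  | push r a s | pop r s | query r s =>
      exact Function.update_of_ne (by simp only [Prog.bound] at hq; omega) _ _
  | seq _ _ ih₁ ih₂ =>
      simp only [Prog.bound, max_le_iff] at hq
      rw [ih₂ hq.2, ih₁ hq.1]
  | test_empty _ _ ih | test_zero _ _ ih | test_one _ _ ih =>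
      simp only [Prog.bound, max_le_iff] at hq
      exact ih (by tauto)
  | loop_done _ => rfl
  | loop_step _ _ _ ih₁ ih₂ =>
      rw [ih₂ hq, ih₁ (by simp only [Prog.bound, max_le_iff] at hq; exact hq.2)]

/-- The program with each register `r` renamed to `g r`. -/
def Prog.rename (g : ℕ → ℕ) : Prog → Prog
  | .skip => .skip
  | .push r a => .push (g r) a
  | .pop r => .pop (g r)
  | .query r => .query (g r)
  | .seq c d => .seq (c.rename g) (d.rename g)
  | .test r c d e => .test (g r) (c.rename g) (d.rename g) (e.rename g)
  | .loop r c => .loop (g r) (c.rename g)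

theorem Prog.QueryFree.rename {g : ℕ → ℕ} {c : Prog} (h : c.QueryFree) :
    (c.rename g).QueryFree := by
  induction c with
  | skip | push | pop => trivial
  | query => exact h
  | seq c d ihc ihd => exact ⟨ihc h.1, ihd h.2⟩
  | test r c d e ihc ihd ihe => exact ⟨ihc h.1, ihd h.2.1, ihe h.2.2⟩
  | loop r c ih => exact ih h

theorem Exec.rename {O : List Bool → List Bool} {g : ℕ → ℕ} (hg : Function.Injective g)
    {c : Prog} {s s' : Store} {t : ℕ} (h : Exec O c s s' t) (S : Store) (hS : S ∘ g = s) :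
    ∃ S' : Store, Exec O (c.rename g) S S' t ∧ S' ∘ g = s' ∧
      ∀ q, q ∉ Set.range g → S' q = S q := by
  have update (S : Store) (r : ℕ) (v : List Bool) :
      Function.update S (g r) v ∘ g = Function.update (S ∘ g) r v ∧
        ∀ q, q ∉ Set.range g → Function.update S (g r) v q = S q :=
    ⟨Function.update_comp_eq_of_injective _ hg _ _,
      fun q hq => Function.update_of_ne (fun h => hq ⟨r, h.symm⟩) _ _⟩
  induction h generalizing S with subst hS
  | skip => exact ⟨S, .skip S, rfl, fun _ _ => rfl⟩
  | push r a => exact ⟨_, .push (g r) a S, update S r _⟩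
  | pop r => exact ⟨_, .pop (g r) S, update S r _⟩
  | query r => exact ⟨_, .query (g r) S, update S r _⟩
  | seq _ _ ih₁ ih₂ =>
      obtain ⟨S₁, e₁, h₁, h₁'⟩ := ih₁ S rfl
      obtain ⟨S₂, e₂, h₂, h₂'⟩ := ih₂ S₁ h₁
      exact ⟨S₂, .seq e₁ e₂, h₂, fun q hq => (h₂' q hq).trans (h₁' q hq)⟩
  | test_empty h _ ih =>
      obtain ⟨S₁, e₁, h₁⟩ := ih S rfl
      exact ⟨S₁, .test_empty h e₁, h₁⟩
  | test_zero h _ ih =>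
      obtain ⟨S₁, e₁, h₁⟩ := ih S rfl
      exact ⟨S₁, .test_zero h e₁, h₁⟩
  | test_one h _ ih =>
      obtain ⟨S₁, e₁, h₁⟩ := ih S rfl
      exact ⟨S₁, .test_one h e₁, h₁⟩
  | loop_done h => exact ⟨S, .loop_done h, rfl, fun _ _ => rfl⟩
  | loop_step h _ _ ih₁ ih₂ =>
      obtain ⟨S₁, e₁, h₁, h₁'⟩ := ih₁ S rfl
      obtain ⟨S₂, e₂, h₂, h₂'⟩ := ih₂ S₁ h₁
      exact ⟨S₂, .loop_step h e₁ e₂, h₂, fun q hq => (h₂' q hq).trans (h₁' q hq)⟩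

/-- Without an oracle, the program `c` leads from `s` to `s'` in at most `T` steps. -/
def Reach (c : Prog) (s s' : Store) (T : ℕ) : Prop :=
  ∃ t ≤ T, Exec (fun _ => []) c s s' t

namespace Reach

theorem mono {c : Prog} {s s' : Store} {T U : ℕ} (h : Reach c s s' T) (hU : T ≤ U) :
    Reach c s s' U := by
  obtain ⟨t, ht, e⟩ := h
  exact ⟨t, ht.trans hU, e⟩

theorem seq {c d : Prog} {s₁ s₂ s₃ : Store} {T U : ℕ} (h₁ : Reach c s₁ s₂ T)
    (h₂ : Reach d s₂ s₃ U) : Reach (.seq c d) s₁ s₃ (T + U) := by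
  obtain ⟨t, ht, e⟩ := h₁
  obtain ⟨u, hu, e'⟩ := h₂
  exact ⟨t + u, by omega, .seq e e'⟩

theorem push (r : ℕ) (a : Bool) (s : Store) :
    Reach (.push r a) s (Function.update s r (a :: s r)) 1 := ⟨1, le_rfl, .push r a s⟩

theorem pop (r : ℕ) (s : Store) :
    Reach (.pop r) s (Function.update s r (s r).tail) 1 := ⟨1, le_rfl, .pop r s⟩

theorem test_empty {r : ℕ} {c d e : Prog} {s s' : Store} {T : ℕ} (hr : s r = [])
    (h : Reach c s s' T) : Reach (.test r c d e) s s' (T + 1) := by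
  obtain ⟨t, ht, x⟩ := h
  exact ⟨t + 1, by omega, .test_empty hr x⟩

theorem test_zero {r : ℕ} {c d e : Prog} {s s' : Store} {T : ℕ} {l : List Bool}
    (hr : s r = false :: l) (h : Reach d s s' T) : Reach (.test r c d e) s s' (T + 1) := by
  obtain ⟨t, ht, x⟩ := h
  exact ⟨t + 1, by omega, .test_zero hr x⟩

theorem test_one {r : ℕ} {c d e : Prog} {s s' : Store} {T : ℕ} {l : List Bool}
    (hr : s r = true :: l) (h : Reach e s s' T) : Reach (.test r c d e) s s' (T + 1) := by
  obtain ⟨t, ht, x⟩ := h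
  exact ⟨t + 1, by omega, .test_one hr x⟩

theorem loop_done {r : ℕ} {c : Prog} {s : Store} (hr : s r = []) : Reach (.loop r c) s s 1 :=
  ⟨1, le_rfl, .loop_done hr⟩

theorem loop_step {r : ℕ} {c : Prog} {s₁ s₂ s₃ : Store} {T U : ℕ} (hr : s₁ r ≠ [])
    (h₁ : Reach c s₁ s₂ T) (h₂ : Reach (.loop r c) s₂ s₃ U) :
    Reach (.loop r c) s₁ s₃ (T + U + 1) := by
  obtain ⟨t, ht, e⟩ := h₁
  obtain ⟨u, hu, e'⟩ := h₂
  exact ⟨t + u + 1, by omega, .loop_step hr e e'⟩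

end Reach

/-- The store with the given contents of the registers `0`, `1`, `2`, `3`, and with all other
registers empty. -/
def regs (x₀ x₁ x₂ x₃ : List Bool) : Store
  | 0 => x₀
  | 1 => x₁
  | 2 => x₂
  | 3 => x₃
  | _ + 4 => []

section regs
variable (x₀ x₁ x₂ x₃ y : List Bool)

@[simp] theorem regs_zero : regs x₀ x₁ x₂ x₃ 0 = x₀ := rfl
@[simp] theorem regs_one : regs x₀ x₁ x₂ x₃ 1 = x₁ := rfl
@[simp] theorem regs_two : regs x₀ x₁ x₂ x₃ 2 = x₂ := rfl
@[simp] theorem regs_three : regs x₀ x₁ x₂ x₃ 3 = x₃ := rfl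

@[simp] theorem update_regs_zero :
    Function.update (regs x₀ x₁ x₂ x₃) 0 y = regs y x₁ x₂ x₃ := by
  funext r; rcases r with _ | _ | _ | _ | r <;> simp [regs]
@[simp] theorem update_regs_one :
    Function.update (regs x₀ x₁ x₂ x₃) 1 y = regs x₀ y x₂ x₃ := by
  funext r; rcases r with _ | _ | _ | _ | r <;> simp [regs]
@[simp] theorem update_regs_two :
    Function.update (regs x₀ x₁ x₂ x₃) 2 y = regs x₀ x₁ y x₃ := by
  funext r; rcases r with _ | _ | _ | _ | r <;> simp [regs]
@[simp] theorem update_regs_three :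
    Function.update (regs x₀ x₁ x₂ x₃) 3 y = regs x₀ x₁ x₂ y := by
  funext r; rcases r with _ | _ | _ | _ | r <;> simp [regs]

theorem inputStore_eq_regs (w : List Bool) : inputStore w = regs w [] [] [] := by
  funext r; rcases r with _ | _ | _ | _ | r <;> simp [inputStore, regs]

end regs

namespace Prog

/-- Take the bits off register `r` one by one, and run `acts a` for each bit `a`. -/
def drain (r : ℕ) (acts : Bool → Prog) : Prog :=
  .loop r (.test r .skip (.seq (.pop r) (acts false)) (.seq (.pop r) (acts true)))

/-- Empty register `r`. -/
def clear (r : ℕ) : Prog := drain r fun _ => .skip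

/-- Empty register `r` onto register `q`, which reverses the order of the bits. -/
def move (r q : ℕ) : Prog := drain r (.push q)

/-- Copy register `0` to the empty register `1`, with the help of register `2`. -/
def dup : Prog := .seq (move 0 2) (drain 2 fun a => .seq (.push 0 a) (.push 1 a))

/-- Prepend the self-delimiting form of the reversal of register `2` to register `0`. -/
def pack : Prog := .seq (.push 0 false) (drain 2 fun a => .seq (.push 0 a) (.push 0 true))

/-- The loop of `unpack`. Register `3` is a flag that stays nonempty until the end mark of the
self-delimiting string has been read. -/
def unpackLoop : Prog :=
  .loop 3 (.test 0 .skip (.seq (.pop 0) (.pop 3))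
    (.seq (.pop 0) (.test 0 .skip (.seq (.pop 0) (.push 1 false))
      (.seq (.pop 0) (.push 1 true)))))

/-- Move a self-delimiting string from register `0` to register `1`, in reversed order. -/
def unpack : Prog := .seq (.push 3 true) unpackLoop

/-- Replace register `0` by register `1`, with the help of register `2`. -/
def restore : Prog := .seq (clear 0) (.seq (move 1 2) (move 2 0))

/-- Replace register `0` by register `1`, after saving its reversal in register `2`. -/
def stash : Prog := .seq (move 0 2) (.seq (move 1 3) (move 3 0))

theorem queryFree_drain {r : ℕ} {acts : Bool → Prog} (h : ∀ a, (acts a).QueryFree) :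
    (drain r acts).QueryFree := ⟨trivial, ⟨trivial, h _⟩, ⟨trivial, h _⟩⟩

theorem queryFree_clear (r : ℕ) : (clear r).QueryFree := queryFree_drain fun _ => trivial

theorem queryFree_move (r q : ℕ) : (move r q).QueryFree := queryFree_drain fun _ => trivial

theorem queryFree_dup : dup.QueryFree :=
  ⟨queryFree_move _ _, queryFree_drain fun _ => ⟨trivial, trivial⟩⟩

theorem queryFree_pack : pack.QueryFree := ⟨trivial, queryFree_drain fun _ => ⟨trivial, trivial⟩⟩

theorem queryFree_unpack : unpack.QueryFree := by simp [unpack, unpackLoop, QueryFree]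

theorem queryFree_restore : restore.QueryFree :=
  ⟨queryFree_clear _, queryFree_move _ _, queryFree_move _ _⟩

theorem queryFree_stash : stash.QueryFree :=
  ⟨queryFree_move _ _, queryFree_move _ _, queryFree_move _ _⟩

end Prog

namespace Reach

/-- In the store `s w u` the bits `w` are still to be processed, and the bits `u` have been
processed, the last one first. -/
theorem drain {r : ℕ} {acts : Bool → Prog} {s : List Bool → List Bool → Store} {T : ℕ}
    (hs : ∀ w u v, Function.update (s w u) r v = s v u)
    (hstep : ∀ a w u, Reach (acts a) (s w u) (s w (a :: u)) T) (w u : List Bool) :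
    Reach (.drain r acts) (s w u) (s [] (w.reverse ++ u)) ((T + 3) * w.length + 1) := by
  have hr (w u : List Bool) : s w u r = w := by rw [← hs w u w, Function.update_self]
  induction w generalizing u with
  | nil => exact loop_done (hr [] u)
  | cons a w ih =>
      have hpop := pop r (s (a :: w) u)
      rw [hs, hr, List.tail_cons] at hpop
      have hbody : Reach (.test r .skip (.seq (.pop r) (acts false)) (.seq (.pop r) (acts true)))
          (s (a :: w) u) (s w (a :: u)) (1 + T + 1) := by
        cases a
        · exact test_zero (hr _ u) (hpop.seq (hstep _ w u))
        · exact test_one (hr _ u) (hpop.seq (hstep _ w u))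
      have hloop := loop_step (by simp [hr]) hbody (ih (a :: u))
      rw [List.reverse_cons, List.append_assoc, List.singleton_append, List.length_cons]
      exact hloop.mono (by grind)

theorem clear (r : ℕ) (s : Store) :
    Reach (.clear r) s (Function.update s r []) (4 * (s r).length + 1) := by
  simpa [Prog.clear] using drain (r := r) (s := fun w _ => Function.update s r w)
    (fun _ _ _ => Function.update_idem _ _ _) (fun _ _ _ => ⟨1, le_rfl, .skip _⟩) (s r) []

theorem move {r q : ℕ} (hrq : r ≠ q) (s : Store) :
    Reach (.move r q) s (Function.update (Function.update s r []) q ((s r).reverse ++ s q))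
      (4 * (s r).length + 1) := by
  have h := drain (r := r) (acts := .push q)
    (s := fun w u => Function.update (Function.update s r w) q u)
    (fun w u v => by rw [Function.update_comm hrq.symm, Function.update_idem])
    (fun a w u => by simpa using push q a (Function.update (Function.update s r w) q u))
    (s r) (s q)
  simpa [Prog.move] using h

theorem dup (w : List Bool) :
    Reach .dup (regs w [] [] []) (regs w w [] []) (9 * w.length + 2) := by
  have hcopy := drain (r := 2) (acts := fun a => .seq (.push 0 a) (.push 1 a))
    (s := fun w u => regs u u w []) (fun _ _ _ => by simp)
    (fun a w u => by simpa using (push 0 a (regs u u w [])).seq (push 1 a _)) w.reverse []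
  have hmove := move (r := 0) (q := 2) (by decide) (regs w [] [] [])
  exact (hmove.seq (by simpa using hcopy)).mono (by simp; omega)

theorem pack (w x y : List Bool) :
    Reach .pack (regs y x w.reverse []) (regs (block w ++ y) x [] []) (5 * w.length + 2) := by
  have hcopy := drain (r := 2) (acts := fun a => .seq (.push 0 a) (.push 0 true))
    (s := fun w u => regs (block u ++ y) x w []) (fun _ _ _ => by simp)
    (fun a w u => by
      simpa [block] using (push 0 a (regs (block u ++ y) x w [])).seq (push 0 true _))
    w.reverse []
  have hmark := push 0 false (regs y x w.reverse [])
  exact (hmark.seq (by simpa [block] using hcopy)).mono (by omega)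

theorem unpackLoop (w u y : List Bool) :
    Reach .unpackLoop (regs (block w ++ y) u [] [true]) (regs y (w.reverse ++ u) [] [])
      (6 * w.length + 5) := by
  induction w generalizing u with
  | nil =>
      have hmark := (pop 0 (regs (block [] ++ y) u [] [true])).seq (pop 3 _)
      simp only [block, regs_zero, update_regs_zero, regs_three, update_regs_three,
        List.singleton_append, List.tail_cons] at hmark
      exact (loop_step (by simp) (test_zero (l := y) rfl hmark) (loop_done rfl)).mono (by simp)
  | cons a w ih =>
      have hpop := pop 0 (regs (block (a :: w) ++ y) u [] [true])
      have hbit := (pop 0 (regs (a :: (block w ++ y)) u [] [true])).seq (push 1 a _)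
      simp only [block, regs_zero, update_regs_zero, regs_one, update_regs_one,
        List.cons_append, List.tail_cons] at hpop hbit
      have htest : Reach (.test 0 .skip (.seq (.pop 0) (.push 1 false))
          (.seq (.pop 0) (.push 1 true))) (regs (a :: (block w ++ y)) u [] [true])
          (regs (block w ++ y) (a :: u) [] [true]) 3 := by
        cases a
        · exact test_zero rfl hbit
        · exact test_one rfl hbit
      have hloop := loop_step (by simp) (test_one (c := .skip) (d := .seq (.pop 0) (.pop 3))
        (l := a :: (block w ++ y)) rfl (hpop.seq htest)) (ih (a :: u))
      simpa [block, Prog.unpackLoop] using hloop.mono (U := 6 * (w.length + 1) + 5) (by omega)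

theorem unpack (w y : List Bool) :
    Reach .unpack (regs (block w ++ y) [] [] []) (regs y w.reverse [] []) (6 * w.length + 6) := by
  have hflag := push 3 true (regs (block w ++ y) [] [] [])
  exact (hflag.seq (by simpa using unpackLoop w [] y)).mono (by omega)

theorem restore (x y : List Bool) :
    Reach .restore (regs x y [] []) (regs y [] [] []) (4 * x.length + 8 * y.length + 3) := by
  have h := (clear 0 (regs x y [] [])).seq ((move (r := 1) (q := 2) (by decide) _).seq
    (move (r := 2) (q := 0) (by decide) _))
  simp only [regs_zero, regs_one, regs_two, update_regs_zero, update_regs_one, update_regs_two,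
    List.append_nil, List.reverse_reverse, List.length_reverse] at h
  exact h.mono (by omega)

theorem stash (x y : List Bool) :
    Reach .stash (regs y x [] []) (regs x [] y.reverse []) (8 * x.length + 4 * y.length + 3) := by
  have h := (move (r := 0) (q := 2) (by decide) (regs y x [] [])).seq
    ((move (r := 1) (q := 3) (by decide) _).seq (move (r := 3) (q := 0) (by decide) _))
  simp only [regs_zero, regs_one, regs_two, regs_three, update_regs_zero, update_regs_one,
    update_regs_two, update_regs_three, List.append_nil, List.reverse_reverse,
    List.length_reverse] at h
  exact h.mono (by omega)

end Reach

/-! ### Polynomial time maps between families of bit strings -/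

/-- On the instances `i`, the number `f i` is bounded by a polynomial in the size `n i`. -/
def PolyBounded {ι : Type*} (n f : ι → ℕ) : Prop := ∃ p : Polynomial ℕ, ∀ i, f i ≤ p.eval (n i)

theorem polynomial_eval_mono (p : Polynomial ℕ) : Monotone fun n => p.eval n := by
  intro m n h
  induction p using Polynomial.induction_on' with
  | add p q hp hq =>
      simp only [Polynomial.eval_add]
      exact Nat.add_le_add hp hq
  | monomial k a =>
      simp only [Polynomial.eval_monomial]
      gcongr

namespace PolyBounded

variable {ι κ : Type*} {n m f g : ι → ℕ}

theorem refl (n : ι → ℕ) : PolyBounded n n := ⟨.X, fun _ => by simp⟩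

theorem const (n : ι → ℕ) (a : ℕ) : PolyBounded n fun _ => a := ⟨.C a, fun _ => by simp⟩

theorem mono (hg : PolyBounded n g) (h : ∀ i, f i ≤ g i) : PolyBounded n f := by
  obtain ⟨p, hp⟩ := hg
  exact ⟨p, fun i => (h i).trans (hp i)⟩

theorem add (hf : PolyBounded n f) (hg : PolyBounded n g) : PolyBounded n fun i => f i + g i := by
  obtain ⟨p, hp⟩ := hf
  obtain ⟨q, hq⟩ := hg
  exact ⟨p + q, fun i => by simpa using Nat.add_le_add (hp i) (hq i)⟩

theorem mul (hf : PolyBounded n f) (hg : PolyBounded n g) : PolyBounded n fun i => f i * g i := by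
  obtain ⟨p, hp⟩ := hf
  obtain ⟨q, hq⟩ := hg
  exact ⟨p * q, fun i => by simpa using Nat.mul_le_mul (hp i) (hq i)⟩

theorem const_mul (a : ℕ) (hf : PolyBounded n f) : PolyBounded n fun i => a * f i :=
  (const n a).mul hf

theorem trans (hm : PolyBounded n m) (hf : PolyBounded m f) : PolyBounded n f := by
  obtain ⟨p, hp⟩ := hf
  obtain ⟨q, hq⟩ := hm
  refine ⟨p.comp q, fun i => ?_⟩
  rw [Polynomial.eval_comp]
  exact (hp i).trans (polynomial_eval_mono p (hq i))

theorem reindex (hf : PolyBounded n f) (e : κ → ι) :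
    PolyBounded (fun k => n (e k)) fun k => f (e k) := by
  obtain ⟨p, hp⟩ := hf
  exact ⟨p, fun k => hp (e k)⟩

end PolyBounded

/-- A single query-free program leads from `s i` to `s' i`, for every instance `i`, in time
polynomial in the size `n i`. -/
def PolyReach {ι : Type*} (n : ι → ℕ) (s s' : ι → Store) : Prop :=
  ∃ c : Prog, c.QueryFree ∧ ∃ T : ι → ℕ, PolyBounded n T ∧ ∀ i, Reach c (s i) (s' i) (T i)

namespace PolyReach

variable {ι κ : Type*} {n m : ι → ℕ} {s s₁ s₂ s₃ : ι → Store}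

theorem seq (h₁ : PolyReach n s₁ s₂) (h₂ : PolyReach n s₂ s₃) : PolyReach n s₁ s₃ := by
  obtain ⟨c, hc, T, hT, h₁⟩ := h₁
  obtain ⟨d, hd, U, hU, h₂⟩ := h₂
  exact ⟨.seq c d, ⟨hc, hd⟩, _, hT.add hU, fun i => (h₁ i).seq (h₂ i)⟩

theorem of_polyBounded (h : PolyReach m s₁ s₂) (hm : PolyBounded n m) : PolyReach n s₁ s₂ := by
  obtain ⟨c, hc, T, hT, h⟩ := h
  exact ⟨c, hc, T, hm.trans hT, h⟩

theorem reindex (h : PolyReach n s₁ s₂) (e : κ → ι) :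
    PolyReach (fun k => n (e k)) (fun k => s₁ (e k)) fun k => s₂ (e k) := by
  obtain ⟨c, hc, T, hT, h⟩ := h
  exact ⟨c, hc, _, hT.reindex e, fun k => h (e k)⟩

theorem test (r : ℕ) (h : ∀ o : Option Bool,
      PolyReach (fun i : {i // (s₁ i r).head? = o} => n i) (fun i => s₁ i) fun i => s₂ i) :
    PolyReach n s₁ s₂ := by
  choose c hc T hT h using h
  choose p hp using hT
  refine ⟨.test r (c none) (c (some false)) (c (some true)), ⟨hc _, hc _, hc _⟩, _,
    ⟨p none + p (some false) + p (some true) + 1, fun i => le_rfl⟩, fun i => ?_⟩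
  have hi (o : Option Bool) (ho : (s₁ i r).head? = o) :
      Reach (c o) (s₁ i) (s₂ i) ((p o).eval (n i)) := (h o ⟨i, ho⟩).mono (hp o ⟨i, ho⟩)
  simp only [Polynomial.eval_add, Polynomial.eval_one]
  match hr : s₁ i r with
  | [] => exact (Reach.test_empty hr (hi none (by simp [hr]))).mono (by omega)
  | false :: w => exact (Reach.test_zero hr (hi (some false) (by simp [hr]))).mono (by omega)
  | true :: w => exact (Reach.test_one hr (hi (some true) (by simp [hr]))).mono (by omega)

theorem clear (r : ℕ) (s : ι → Store) :
    PolyReach (fun i => (s i r).length) s fun i => Function.update (s i) r [] :=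
  ⟨_, Prog.queryFree_clear r, _, ((PolyBounded.refl _).const_mul 4).add (.const _ 1),
    fun i => Reach.clear r (s i)⟩

end PolyReach

/-- A query-free program transforms the strings `inp i` into the strings `out i` in polynomial
time, leaving all other registers empty. -/
def PolyTimeMap {ι : Type*} (inp out : ι → List Bool) : Prop :=
  PolyReach (fun i => (inp i).length) (fun i => inputStore (inp i)) fun i => inputStore (out i)

/-- The renaming of registers that makes the registers `1`, `2`, `3` available. -/
def frameMap (r : ℕ) : ℕ := if r = 0 then 0 else r + 3

theorem frameMap_injective : Function.Injective frameMap := by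
  intro a b h
  simp only [frameMap] at h
  split_ifs at h <;> omega

theorem Reach.frame {c : Prog} {x y : List Bool} {T : ℕ}
    (h : Reach c (inputStore x) (inputStore y) T) (x₁ x₂ x₃ : List Bool) :
    Reach (c.rename frameMap) (regs x x₁ x₂ x₃) (regs y x₁ x₂ x₃) T := by
  obtain ⟨t, ht, e⟩ := h
  obtain ⟨S, e', h₁, h₂⟩ := e.rename frameMap_injective (regs x x₁ x₂ x₃) (by
    funext r
    cases r <;> simp [frameMap, inputStore, regs])
  have hrange {q : ℕ} (hq : 0 < q ∧ q < 4) : q ∉ Set.range frameMap := by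
    rintro ⟨r, rfl⟩
    simp only [frameMap] at hq
    split_ifs at hq <;> omega
  suffices hS : S = regs y x₁ x₂ x₃ from ⟨t, ht, hS ▸ e'⟩
  funext q
  rcases q with _ | _ | _ | _ | q
  · simpa [frameMap, inputStore] using congrFun h₁ 0
  · exact h₂ 1 (hrange (by decide))
  · exact h₂ 2 (hrange (by decide))
  · exact h₂ 3 (hrange (by decide))
  · simpa [frameMap, inputStore, regs] using congrFun h₁ (q + 1)

theorem length_block (w : List Bool) : (block w).length = 2 * w.length + 1 := by
  induction w with
  | nil => rfl
  | cons a w ih => simp only [block, List.length_cons, ih]; omega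

namespace PolyTimeMap

variable {ι κ : Type*} {inp mid out out₁ out₂ : ι → List Bool}

theorem polyReach_regs (h : PolyTimeMap inp out) (x₁ x₂ x₃ : ι → List Bool) :
    PolyReach (fun i => (inp i).length) (fun i => regs (inp i) (x₁ i) (x₂ i) (x₃ i))
      fun i => regs (out i) (x₁ i) (x₂ i) (x₃ i) := by
  obtain ⟨c, hc, T, hT, h⟩ := h
  exact ⟨_, hc.rename, T, hT, fun i => (h i).frame _ _ _⟩

theorem iff_polyReach_regs : PolyTimeMap inp out ↔ PolyReach (fun i => (inp i).length)
    (fun i => regs (inp i) [] [] []) fun i => regs (out i) [] [] [] := by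
  simp only [PolyTimeMap, inputStore_eq_regs]

theorem length_le (h : PolyTimeMap inp out) :
    PolyBounded (fun i => (inp i).length) fun i => (out i).length := by
  obtain ⟨c, hc, T, hT, h⟩ := h
  refine ((PolyBounded.refl _).add hT).mono fun i => ?_
  obtain ⟨t, ht, e⟩ := h i
  exact (e.length_le hc 0).trans (Nat.add_le_add_left ht _)

theorem reindex (h : PolyTimeMap inp out) (e : κ → ι) :
    PolyTimeMap (fun k => inp (e k)) fun k => out (e k) :=
  PolyReach.reindex h e

theorem refl (inp : ι → List Bool) : PolyTimeMap inp inp :=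
  ⟨.skip, trivial, _, .const _ 1, fun _ => ⟨1, le_rfl, .skip _⟩⟩

theorem trans (h₁ : PolyTimeMap inp mid) (h₂ : PolyTimeMap mid out) : PolyTimeMap inp out :=
  PolyReach.seq h₁ (PolyReach.of_polyBounded h₂ h₁.length_le)

theorem nil (inp : ι → List Bool) : PolyTimeMap inp fun _ => [] :=
  iff_polyReach_regs.2 <| by simpa using PolyReach.clear 0 fun i => regs (inp i) [] [] []

theorem cons (a : Bool) (h : PolyTimeMap inp out) : PolyTimeMap inp fun i => a :: out i :=
  h.trans <| iff_polyReach_regs.2 ⟨.push 0 a, trivial, _, .const _ 1,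
    fun i => by simpa using Reach.push 0 a (regs (out i) [] [] [])⟩

theorem tail (h : PolyTimeMap inp out) : PolyTimeMap inp fun i => (out i).tail :=
  h.trans <| iff_polyReach_regs.2 ⟨.pop 0, trivial, _, .const _ 1,
    fun i => by simpa using Reach.pop 0 (regs (out i) [] [] [])⟩

theorem const (inp : ι → List Bool) (w : List Bool) : PolyTimeMap inp fun _ => w := by
  induction w with
  | nil => exact nil inp
  | cons a w ih => exact ih.cons a

theorem polyReach_dup (h : PolyTimeMap inp out) : PolyReach (fun i => (inp i).length)
    (fun i => regs (inp i) [] [] []) fun i => regs (out i) (inp i) [] [] :=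
  PolyReach.seq
    ⟨_, Prog.queryFree_dup, _, ((PolyBounded.refl _).const_mul 9).add (.const _ 2),
      fun i => Reach.dup (inp i)⟩
    (h.polyReach_regs inp (fun _ => []) fun _ => [])

theorem polyReach_fork (h₁ : PolyTimeMap inp out₁) (h₂ : PolyTimeMap inp out₂) :
    PolyReach (fun i => (inp i).length)
      (fun i => regs (inp i) [] [] []) fun i => regs (out₂ i) [] (out₁ i).reverse [] := by
  have hstash : PolyReach (fun i => (inp i).length)
      (fun i => regs (out₁ i) (inp i) [] []) fun i => regs (inp i) [] (out₁ i).reverse [] :=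
    ⟨_, Prog.queryFree_stash, _,
      (((PolyBounded.refl _).const_mul 8).add (h₁.length_le.const_mul 4)).add (.const _ 3),
      fun i => Reach.stash (inp i) (out₁ i)⟩
  exact (h₁.polyReach_dup.seq hstash).seq (h₂.polyReach_regs _ _ _)

theorem pair (h₁ : PolyTimeMap inp out₁) (h₂ : PolyTimeMap inp out₂) :
    PolyTimeMap inp fun i => block (out₁ i) ++ out₂ i :=
  iff_polyReach_regs.2 <| (h₁.polyReach_fork h₂).seq
    ⟨_, Prog.queryFree_pack, _, (h₁.length_le.const_mul 5).add (.const _ 2),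
      fun i => Reach.pack (out₁ i) [] (out₂ i)⟩

theorem polyReach_unpack (v w : ι → List Bool) :
    PolyReach (fun i => (block (v i) ++ w i).length)
      (fun i => regs (block (v i) ++ w i) [] [] []) fun i => regs (w i) (v i).reverse [] [] := by
  refine ⟨_, Prog.queryFree_unpack, _, ?_, fun i => Reach.unpack (v i) (w i)⟩
  refine (((PolyBounded.refl _).const_mul 6).add (.const _ 6)).mono fun i => ?_
  rw [List.length_append, length_block]
  omega

theorem polyReach_move (v w : ι → List Bool) :
    PolyReach (fun i => (v i).length)
      (fun i => regs (w i) (v i).reverse [] []) fun i => regs (v i ++ w i) [] [] [] :=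
  ⟨_, Prog.queryFree_move 1 0, _, ((PolyBounded.refl _).const_mul 4).add (.const _ 1), fun i => by
    simpa using Reach.move (r := 1) (q := 0) (by decide) (regs (w i) (v i).reverse [] [])⟩

theorem polyBounded_block_append (v w : ι → List Bool) :
    PolyBounded (fun i => (block (v i) ++ w i).length) fun i => (v i).length + (w i).length :=
  (PolyBounded.refl _).mono fun i => by
    rw [List.length_append, length_block]
    omega

theorem append_of_block (v w : ι → List Bool) :
    PolyTimeMap (fun i => block (v i) ++ w i) fun i => v i ++ w i :=
  iff_polyReach_regs.2 <| (polyReach_unpack v w).seq <| (polyReach_move v w).of_polyBounded <|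
    (polyBounded_block_append v w).mono fun _ => Nat.le_add_right _ _

theorem fst (v w : ι → List Bool) : PolyTimeMap (fun i => block (v i) ++ w i) v := by
  have hclear := PolyReach.clear 0 fun i => regs (w i) (v i).reverse [] []
  have hmove := polyReach_move v fun _ => []
  simp only [regs_zero, update_regs_zero, List.append_nil] at hclear hmove
  refine iff_polyReach_regs.2 <| (polyReach_unpack v w).seq <|
    (hclear.of_polyBounded ?_).seq (hmove.of_polyBounded ?_)
  · exact (polyBounded_block_append v w).mono fun _ => Nat.le_add_left _ _
  · exact (polyBounded_block_append v w).mono fun _ => Nat.le_add_right _ _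

theorem snd (v w : ι → List Bool) : PolyTimeMap (fun i => block (v i) ++ w i) w := by
  have hclear := PolyReach.clear 1 fun i => regs (w i) (v i).reverse [] []
  simp only [regs_one, update_regs_one, List.length_reverse] at hclear
  exact iff_polyReach_regs.2 <| (polyReach_unpack v w).seq <| hclear.of_polyBounded <|
    (polyBounded_block_append v w).mono fun _ => Nat.le_add_right _ _

theorem append (h₁ : PolyTimeMap inp out₁) (h₂ : PolyTimeMap inp out₂) :
    PolyTimeMap inp fun i => out₁ i ++ out₂ i :=
  (h₁.pair h₂).trans (append_of_block out₁ out₂)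

theorem cases {cnd : ι → List Bool} (hc : PolyTimeMap inp cnd) (h : ∀ o : Option Bool,
      PolyTimeMap (fun i : {i // (cnd i).head? = o} => inp i) fun i => out i) :
    PolyTimeMap inp out := by
  refine iff_polyReach_regs.2 <| hc.polyReach_dup.seq <| PolyReach.test 0 fun o => ?_
  have hrestore : PolyReach (fun i => (inp i).length)
      (fun i => regs (cnd i) (inp i) [] []) fun i => regs (inp i) [] [] [] :=
    ⟨_, Prog.queryFree_restore, _,
      ((hc.length_le.const_mul 4).add ((PolyBounded.refl _).const_mul 8)).add (.const _ 3),
      fun i => Reach.restore (cnd i) (inp i)⟩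
  exact (hrestore.reindex Subtype.val).seq (iff_polyReach_regs.1 (h o))

theorem iterate {cnt : ι → List Bool} {st : ι → ℕ → List Bool} {B : ι → ℕ}
    (hcnt : PolyTimeMap inp cnt) (hinit : PolyTimeMap inp fun i => st i 0)
    (hstep : PolyTimeMap (fun x : ι × ℕ => st x.1 x.2) fun x => st x.1 (x.2 + 1))
    (hB : PolyBounded (fun i => (inp i).length) B) (hst : ∀ i k, (st i k).length ≤ B i) :
    PolyTimeMap inp fun i => st i (cnt i).length := by
  refine iff_polyReach_regs.2 <| (hcnt.polyReach_fork hinit).seq ?_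
  obtain ⟨c, hc, T, ⟨p, hT⟩, hstep⟩ := hstep
  refine ⟨.drain 2 fun _ => c.rename frameMap, Prog.queryFree_drain fun _ => hc.rename,
    fun i => (p.eval (B i) + 3) * (cnt i).length + 1,
    (((hB.trans ⟨p, fun _ => le_rfl⟩).add (.const _ 3)).mul hcnt.length_le).add (.const _ 1),
    fun i => ?_⟩
  have hdrain := Reach.drain (r := 2) (acts := fun _ => c.rename frameMap)
    (s := fun w u => regs (st i u.length) [] w []) (fun _ _ _ => by simp)
    (fun _ w u => ((hstep (i, u.length)).frame [] w []).mono
      ((hT _).trans (polynomial_eval_mono p (hst i u.length)))) (cnt i).reverse []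
  simpa using hdrain

end PolyTimeMap

namespace Prog

/-- Empty the registers `1, …, n`. -/
def clearUpTo : ℕ → Prog
  | 0 => .skip
  | n + 1 => .seq (clearUpTo n) (.clear (n + 1))

theorem queryFree_clearUpTo : ∀ n, (clearUpTo n).QueryFree
  | 0 => trivial
  | n + 1 => ⟨queryFree_clearUpTo n, queryFree_clear _⟩

end Prog

theorem Reach.clearUpTo (n : ℕ) (s : Store) {B : ℕ} (hB : ∀ r, (s r).length ≤ B) :
    Reach (.clearUpTo n) s (fun r => if r ∈ Set.Icc 1 n then [] else s r)
      (1 + n * (4 * B + 1)) := by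
  induction n with
  | zero =>
      simp only [Set.Icc_eq_empty (by omega : ¬ 1 ≤ 0), Set.mem_empty_iff_false, if_false]
      exact ⟨1, by simp, .skip s⟩
  | succ n ih =>
      have h := ih.seq (Reach.clear (n + 1) _)
      rw [if_neg (by simp)] at h
      convert h.mono (U := 1 + (n + 1) * (4 * B + 1)) (by have := hB (n + 1); grind) using 1
      · rfl
      funext r
      by_cases hr : r = n + 1
      · simp [hr]
      · rw [Function.update_of_ne hr]
        exact if_congr (by simp only [Set.mem_Icc]; omega) rfl rfl

namespace PolyTimeMap

variable {ι : Type*} {inp out : ι → List Bool}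

theorem of_polyTimeSolvable {R : ι → List Bool → Prop} (h : PolyTimeSolvable inp R) :
    ∃ out : ι → List Bool, PolyTimeMap inp out ∧ ∀ i, R i (out i) := by
  obtain ⟨c, hc, p, hp⟩ := h
  choose out t hcomp ht hR using hp
  choose s hexec hs using hcomp
  have hlen (i : ι) (r : ℕ) : (s i r).length ≤ (inp i).length + t i := by
    have hinp : (inputStore (inp i) r).length ≤ (inp i).length := by
      simp only [inputStore]
      split_ifs <;> simp
    exact ((hexec i).length_le hc r).trans (Nat.add_le_add_right hinp _)
  have hfinal (i : ι) :
      (fun r => if r ∈ Set.Icc 1 c.bound then [] else s i r) = inputStore (out i) := by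
    funext r
    rcases Nat.eq_zero_or_pos r with rfl | hr
    · simp [inputStore, hs]
    by_cases hb : r ≤ c.bound
    · simp [inputStore, hr.ne', Nat.one_le_iff_ne_zero, hb]
    · rw [if_neg (by simp only [Set.mem_Icc]; omega), (hexec i).eq_of_bound_le (by omega)]
      simp [inputStore, hr.ne']
  have ht' : PolyBounded (fun i => (inp i).length) t := ⟨p, ht⟩
  have hclear : PolyReach (fun i => (inp i).length) s fun i => inputStore (out i) :=
    ⟨_, Prog.queryFree_clearUpTo c.bound, _, (PolyBounded.const _ 1).add
      (((((PolyBounded.refl _).add ht').const_mul 4).add (.const _ 1)).const_mul c.bound),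
      fun i => by simpa only [hfinal] using Reach.clearUpTo c.bound (s i) (hlen i)⟩
  exact ⟨out, PolyReach.seq ⟨c, hc, t, ht', fun i => ⟨t i, le_rfl, hexec i⟩⟩ hclear, hR⟩

theorem mem_polyTimeClass (O : List Bool → List Bool) {X : PromiseProblem}
    (h : PolyTimeMap inp out)
    (hX : ∀ w ∈ X.accept ∪ X.reject, ∃ i, inp i = w ∧ (w ∈ X.accept → out i = [true]) ∧
      (w ∈ X.reject → out i = [false])) : X ∈ PolyTimeClass O := by
  obtain ⟨c, hc, T, ⟨p, hT⟩, h⟩ := h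
  refine ⟨c, p, fun ⟨w, hw⟩ => ?_⟩
  obtain ⟨i, rfl, haccept, hreject⟩ := hX w hw
  obtain ⟨t, ht, e⟩ := h i
  exact ⟨out i, t, ⟨_, e.of_queryFree hc, by simp [inputStore]⟩, ht.trans (hT i), haccept,
    hreject⟩

end PolyTimeMap

/-! ### Polynomial time functions between encoded types -/

/-- A choice of bit strings representing the elements of a type; it need not be injective. -/
class BitEncodable (α : Type*) where
  /-- The bit string representing an element. -/
  enc : α → List Bool

/-- The encoding of `α` by bit strings is injective. -/
class InjBitEncodable (α : Type*) [BitEncodable α] : Prop where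
  enc_injective : Function.Injective (BitEncodable.enc : α → List Bool)

open BitEncodable

instance {α : Type*} [BitEncodable α] : BitEncodable (List α) := ⟨fun l => encList (l.map enc)⟩

-- Strings represent themselves; no encoding is put on `Bool`, which would induce another one.
instance (priority := high) : BitEncodable (List Bool) := ⟨fun w => w⟩

instance {α β : Type*} [BitEncodable α] [BitEncodable β] : BitEncodable (α × β) :=
  ⟨fun x => block (enc x.1) ++ enc x.2⟩

instance {α : Type*} [BitEncodable α] {p : α → Prop} : BitEncodable (Subtype p) :=
  ⟨fun x => enc x.1⟩

instance : BitEncodable ℤ := ⟨encInt⟩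

section Encoding

variable {α β : Type*} [BitEncodable α] [BitEncodable β]

theorem enc_prod (a : α) (b : β) : enc (a, b) = block (enc a) ++ enc b := rfl

theorem enc_nil : enc ([] : List α) = [] := rfl

theorem enc_cons (a : α) (l : List α) : enc (a :: l) = enc (a, l) := rfl

theorem enc_append (l l' : List α) : enc (l ++ l') = enc l ++ enc l' := by
  simp [enc, encList]

theorem length_enc_prod (a : α) (b : β) :
    (enc (a, b)).length = 2 * (enc a).length + 1 + (enc b).length := by
  rw [enc_prod, List.length_append, length_block]

theorem length_enc_cons (a : α) (l : List α) :
    (enc (a :: l)).length = 2 * (enc a).length + 1 + (enc l).length :=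
  length_enc_prod a l

theorem length_enc_append (l l' : List α) :
    (enc (l ++ l')).length = (enc l).length + (enc l').length := by
  rw [enc_append, List.length_append]

theorem length_le_length_enc (l : List α) : l.length ≤ (enc l).length := by
  induction l with
  | nil => simp
  | cons a l ih => rw [length_enc_cons, List.length_cons]; omega

theorem length_enc_le_of_mem {a : α} {l : List α} (h : a ∈ l) :
    (enc a).length ≤ (enc l).length := by
  obtain ⟨u, v, rfl⟩ := List.append_of_mem h
  rw [length_enc_append, length_enc_cons]
  omega

theorem length_enc_le_of_forall {l : List α} {B : ℕ} (h : ∀ a ∈ l, (enc a).length ≤ B) :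
    (enc l).length ≤ l.length * (2 * B + 1) := by
  induction l with
  | nil => simp [enc_nil]
  | cons b l ih =>
      rw [length_enc_cons, List.length_cons, add_mul]
      have := ih fun a ha => h a (List.mem_cons_of_mem _ ha)
      have := h b List.mem_cons_self
      omega

theorem length_enc_flatMap_le {ι : Type*} {l : List ι} {f : ι → List β} {B : ℕ}
    (h : ∀ a ∈ l, (enc (f a)).length ≤ B) : (enc (l.flatMap f)).length ≤ l.length * B := by
  induction l with
  | nil => simp [enc_nil]
  | cons b l ih =>
      rw [List.flatMap_cons, length_enc_append, List.length_cons, add_mul]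
      have := ih fun a ha => h a (List.mem_cons_of_mem _ ha)
      have := h b List.mem_cons_self
      omega

theorem length_enc_drop_le (l : List α) (k : ℕ) : (enc (l.drop k)).length ≤ (enc l).length := by
  conv_rhs => rw [← List.take_append_drop k l, length_enc_append]
  omega

instance : InjBitEncodable (List Bool) := ⟨Function.injective_id⟩

instance [InjBitEncodable α] [InjBitEncodable β] : InjBitEncodable (α × β) where
  enc_injective := by
    rintro ⟨a, b⟩ ⟨a', b'⟩ h
    obtain ⟨h₁, h₂⟩ := block_append_inj h
    exact Prod.ext (InjBitEncodable.enc_injective h₁) (InjBitEncodable.enc_injective h₂)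

instance [InjBitEncodable α] : InjBitEncodable (List α) where
  enc_injective _ _ h :=
    List.map_injective_iff.2 InjBitEncodable.enc_injective (encList_injective h)

end Encoding

/-- The function `f` is computed on encodings in polynomial time. -/
def PolyTime {α β : Type*} [BitEncodable α] [BitEncodable β] (f : α → β) : Prop :=
  PolyTimeMap (enc : α → List Bool) fun a => enc (f a)

open Classical in
/-- The predicate `p` is decided on encodings in polynomial time. -/
def PolyTimePred {α : Type*} [BitEncodable α] (p : α → Prop) : Prop :=
  PolyTime fun a => [decide (p a)]

theorem foldl_take_succ_prod_drop_succ {σ β : Type*} (f : σ → β → σ) (s : σ) (l : List β) (k : ℕ) :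
    ((l.take (k + 1)).foldl f s, l.drop (k + 1)) =
      List.casesOn (l.drop k) ((l.take k).foldl f s, [])
        fun b t => (f ((l.take k).foldl f s) b, t) := by
  induction k generalizing s l with
  | zero => cases l <;> rfl
  | succ k ih =>
      cases l with
      | nil => rfl
      | cons b l => exact ih (f s b) l

namespace PolyTime

variable {α β γ σ : Type*} [BitEncodable α] [BitEncodable β] [BitEncodable γ] [BitEncodable σ]

theorem of_eq {f g : α → β} (hf : PolyTime f) (h : ∀ a, f a = g a) : PolyTime g :=
  funext h ▸ hf

theorem id : PolyTime fun a : α => a := PolyTimeMap.refl _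

theorem comp {g : β → γ} {f : α → β} (hg : PolyTime g) (hf : PolyTime f) :
    PolyTime fun a => g (f a) :=
  PolyTimeMap.trans hf (PolyTimeMap.reindex hg f)

theorem const (b : β) : PolyTime fun _ : α => b := PolyTimeMap.const _ _

theorem pair {f : α → β} {g : α → γ} (hf : PolyTime f) (hg : PolyTime g) :
    PolyTime fun a => (f a, g a) :=
  PolyTimeMap.pair hf hg

theorem fst {f : α → β × γ} (hf : PolyTime f) : PolyTime fun a => (f a).1 :=
  PolyTimeMap.trans hf (PolyTimeMap.fst _ fun a => enc (f a).2)

theorem snd {f : α → β × γ} (hf : PolyTime f) : PolyTime fun a => (f a).2 :=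
  PolyTimeMap.trans hf (PolyTimeMap.snd (fun a => enc (f a).1) _)

theorem comp₂ {g : β → γ → σ} {u : α → β} {v : α → γ} (hg : PolyTime fun x : β × γ => g x.1 x.2)
    (hu : PolyTime u) (hv : PolyTime v) : PolyTime fun a => g (u a) (v a) :=
  comp hg (hu.pair hv)

theorem cons {f : α → β} {g : α → List β} (hf : PolyTime f) (hg : PolyTime g) :
    PolyTime fun a => f a :: g a :=
  PolyTimeMap.pair hf hg

theorem append {f g : α → List β} (hf : PolyTime f) (hg : PolyTime g) :
    PolyTime fun a => f a ++ g a := by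
  simp only [PolyTime, enc_append]
  exact PolyTimeMap.append hf hg

theorem string_cons (b : Bool) {s : α → List Bool} (hs : PolyTime s) :
    PolyTime fun a => b :: s a :=
  PolyTimeMap.cons b hs

theorem string_tail {s : α → List Bool} (hs : PolyTime s) : PolyTime fun a => (s a).tail :=
  PolyTimeMap.tail hs

theorem string_casesOn {s : α → List Bool} {f : α → β} {g : Bool → α → β} (hs : PolyTime s)
    (hf : PolyTime f) (hg : ∀ b, PolyTime (g b)) :
    PolyTime fun a => List.casesOn (motive := fun _ => β) (s a) (f a) fun b _ => g b a := by
  refine PolyTimeMap.cases hs fun o => ?_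
  match o with
  | none =>
      convert PolyTimeMap.reindex hf Subtype.val with a
      simp only [show s a = [] from List.head?_eq_none_iff.1 a.2]
  | some b =>
      convert PolyTimeMap.reindex (hg b) Subtype.val with a
      obtain ⟨w, hw⟩ := List.head?_eq_some_iff.1 a.2
      simp only [show s a = b :: w from hw]

theorem ite {p : α → Prop} [DecidablePred p] {f g : α → β} (hp : PolyTimePred p)
    (hf : PolyTime f) (hg : PolyTime g) : PolyTime fun a => if p a then f a else g a :=
  (string_casesOn hp hf (g := fun b a => bif b then f a else g a)
    (Bool.forall_bool.2 ⟨hg, hf⟩)).of_eq fun a => by by_cases h : p a <;> simp [h]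

theorem list_casesOn {l : α → List β} {f : α → γ} {g : α → β → List β → γ} (hl : PolyTime l)
    (hf : PolyTime f) (hg : PolyTime fun x : α × β × List β => g x.1 x.2.1 x.2.2) :
    PolyTime fun a => List.casesOn (motive := fun _ => γ) (l a) (f a) (g a) := by
  refine PolyTimeMap.cases hl fun o => ?_
  match o with
  | none =>
      convert PolyTimeMap.reindex hf Subtype.val with a
      rcases h : l a with _ | ⟨b, t⟩
      · simp only [h]
      · exact absurd a.2 (by simp [h, enc_cons, enc_prod, block_ne_nil])
  | some x =>
      have hcons (a : {a // (enc (l a)).head? = some x}) : ∃ b t, l a = b :: t :=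
        List.exists_cons_of_ne_nil fun h => by simpa [h, enc_nil] using a.2
      choose b t hbt using hcons
      have hpair : PolyTimeMap (fun a : {a // (enc (l a)).head? = some x} => enc a)
          fun a => enc (a.1, l a) := PolyTimeMap.reindex (pair id hl) Subtype.val
      simp only [hbt] at hpair ⊢
      exact hpair.trans (PolyTimeMap.reindex hg fun a => (a.1, b a, t a))

theorem foldl {l : α → List β} {init : α → σ} {step : α → σ → β → σ} {B : α → ℕ}
    (hl : PolyTime l) (hinit : PolyTime init)
    (hstep : PolyTime fun x : α × σ × β => step x.1 x.2.1 x.2.2)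
    (hB : PolyBounded (fun a => (enc a).length) B)
    (hfoldl : ∀ a l', l' <+: l a → (enc (l'.foldl (step a) (init a))).length ≤ B a) :
    PolyTime fun a => (l a).foldl (step a) (init a) := by
  let state (a : α) (k : ℕ) : α × σ × List β :=
    (a, ((l a).take k).foldl (step a) (init a), (l a).drop k)
  have hnext : PolyTime fun x : α × σ × List β => (x.1, List.casesOn
      (motive := fun _ => σ × List β) x.2.2 (x.2.1, []) fun b t => (step x.1 x.2.1 b, t)) :=
    id.fst.pair <| list_casesOn (g := fun x b t => (step x.1 x.2.1 b, t)) id.snd.snd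
      (id.snd.fst.pair (const []))
      ((hstep.comp (id.fst.fst.pair (id.fst.snd.fst.pair id.snd.fst))).pair id.snd.snd)
  have hstate : PolyTimeMap (fun x : α × ℕ => enc (state x.1 x.2))
      fun x => enc (state x.1 (x.2 + 1)) := by
    simp only [state, foldl_take_succ_prod_drop_succ]
    exact PolyTimeMap.reindex hnext fun x : α × ℕ => state x.1 x.2
  have hiter : PolyTime fun a => state a (enc (l a)).length :=
    PolyTimeMap.iterate (st := fun a k => enc (state a k)) hl (id.pair (hinit.pair hl)) hstate
      (((((PolyBounded.refl _).const_mul 2).add (hB.const_mul 2)).add hl.length_le).add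
        (.const _ 2)) fun a k => by
      have := hfoldl a _ (List.take_prefix k (l a))
      have := length_enc_drop_le (l a) k
      simp only [state, length_enc_prod]
      omega
  exact hiter.snd.fst.of_eq fun a => by
    simp only [state, List.take_of_length_le (length_le_length_enc (l a))]

theorem flatMap {l : α → List β} {f : α → β → List γ} (hl : PolyTime l)
    (hf : PolyTime fun x : α × β => f x.1 x.2) : PolyTime fun a => (l a).flatMap (f a) := by
  have hfoldl (a : α) (l' : List β) (s : List γ) :
      l'.foldl (fun s b => s ++ f a b) s = s ++ l'.flatMap (f a) := by
    induction l' generalizing s with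
    | nil => simp
    | cons b l' ih => simp [ih]
  obtain ⟨p, hp⟩ := hf.length_le
  have hB : PolyBounded (fun a => (enc a).length) fun a =>
      (enc (l a)).length * p.eval (2 * (enc a).length + 1 + (enc (l a)).length) :=
    hl.length_le.mul <| (((PolyBounded.refl _).const_mul 2).add (.const _ 1)).add hl.length_le
      |>.trans ⟨p, fun _ => le_rfl⟩
  refine (foldl (step := fun a s b => s ++ f a b) hl (const ([] : List γ))
    (id.snd.fst.append (hf.comp (id.fst.pair id.snd.snd))) hB fun a l' hl' => ?_).of_eq
    fun a => by simp [hfoldl]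
  rw [hfoldl, List.nil_append]
  refine (length_enc_flatMap_le fun b hb => (hp (a, b)).trans (polynomial_eval_mono p ?_)).trans
    (Nat.mul_le_mul_right _ (hl'.length_le.trans (length_le_length_enc _)))
  simp only [length_enc_prod]
  exact Nat.add_le_add_left (length_enc_le_of_mem (hl'.subset hb)) _

theorem map {l : α → List β} {f : α → β → γ} (hl : PolyTime l)
    (hf : PolyTime fun x : α × β => f x.1 x.2) : PolyTime fun a => (l a).map (f a) :=
  (flatMap (f := fun a b => [f a b]) hl (hf.cons (const []))).of_eq fun _ =>
    List.map_eq_flatMap.symm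

end PolyTime

/-- Delete the first letters of two strings if they agree. -/
def stripCommonHead : List Bool × List Bool → List Bool × List Bool
  | (a :: v, b :: w) => if a = b then (v, w) else (a :: v, b :: w)
  | x => x

theorem stripCommonHead_fst_eq_snd_iff (x : List Bool × List Bool) :
    (stripCommonHead x).1 = (stripCommonHead x).2 ↔ x.1 = x.2 := by
  rcases x with ⟨_ | ⟨a, v⟩, _ | ⟨b, w⟩⟩ <;> try rfl
  by_cases h : a = b <;> simp [stripCommonHead, h]

theorem length_stripCommonHead_le (x : List Bool × List Bool) :
    (stripCommonHead x).1.length ≤ x.1.length ∧ (stripCommonHead x).2.length ≤ x.2.length := by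
  rcases x with ⟨_ | ⟨a, v⟩, _ | ⟨b, w⟩⟩ <;> try exact ⟨le_rfl, le_rfl⟩
  by_cases h : a = b <;> simp [stripCommonHead, h]

theorem length_iterate_stripCommonHead_le (x : List Bool × List Bool) (k : ℕ) :
    (stripCommonHead^[k] x).1.length ≤ x.1.length ∧
      (stripCommonHead^[k] x).2.length ≤ x.2.length := by
  induction k with
  | zero => exact ⟨le_rfl, le_rfl⟩
  | succ k ih =>
      rw [Function.iterate_succ_apply']
      have h := length_stripCommonHead_le (stripCommonHead^[k] x)
      exact ⟨h.1.trans ih.1, h.2.trans ih.2⟩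

theorem iterate_stripCommonHead_self (w : List Bool) :
    stripCommonHead^[w.length] (w, w) = ([], []) := by
  induction w with
  | nil => rfl
  | cons a w ih => simpa [stripCommonHead] using ih

theorem iterate_stripCommonHead_eq_nil_iff (x : List Bool × List Bool) :
    stripCommonHead^[x.1.length] x = ([], []) ↔ x.1 = x.2 := by
  refine ⟨fun h => ?_, fun h => ?_⟩
  · have hiter (k : ℕ) : (stripCommonHead^[k] x).1 = (stripCommonHead^[k] x).2 ↔ x.1 = x.2 := by
      induction k with
      | zero => rfl
      | succ k ih => rw [Function.iterate_succ_apply', stripCommonHead_fst_eq_snd_iff, ih]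
    exact (hiter x.1.length).1 (by rw [h])
  · rw [show x = (x.1, x.1) from Prod.ext rfl h.symm]
    exact iterate_stripCommonHead_self x.1

theorem polyTime_stripCommonHead : PolyTime stripCommonHead := by
  have hinner (a b : Bool) : PolyTime fun x : List Bool × List Bool =>
      if a = b then (x.1.tail, x.2.tail) else x := by
    by_cases h : a = b
    · simpa only [h, if_true] using PolyTime.id.fst.string_tail.pair PolyTime.id.snd.string_tail
    · simpa only [h, if_false] using PolyTime.id
  refine (PolyTime.string_casesOn PolyTime.id.fst PolyTime.id fun a =>
    PolyTime.string_casesOn PolyTime.id.snd PolyTime.id (hinner a)).of_eq ?_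
  rintro ⟨_ | ⟨a, v⟩, _ | ⟨b, w⟩⟩ <;> rfl

namespace PolyTimePred

variable {α β : Type*} [BitEncodable α] [BitEncodable β]

theorem of_iff {p q : α → Prop} (hp : PolyTimePred p) (h : ∀ a, p a ↔ q a) : PolyTimePred q :=
  (funext fun a => propext (h a) : p = q) ▸ hp

theorem comp {p : β → Prop} {f : α → β} (hp : PolyTimePred p) (hf : PolyTime f) :
    PolyTimePred fun a => p (f a) :=
  PolyTime.comp hp hf

theorem not {p : α → Prop} (hp : PolyTimePred p) : PolyTimePred fun a => ¬ p a := by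
  classical
  exact (PolyTime.ite hp (.const [false]) (.const [true])).of_eq fun a => by
    by_cases h : p a <;> simp [h]

theorem and {p q : α → Prop} (hp : PolyTimePred p) (hq : PolyTimePred q) :
    PolyTimePred fun a => p a ∧ q a := by
  classical
  exact (PolyTime.ite hp hq (.const [false])).of_eq fun a => by by_cases h : p a <;> simp [h]

theorem forall_mem {l : α → List β} {p : α → β → Prop} (hl : PolyTime l)
    (hp : PolyTimePred fun x : α × β => p x.1 x.2) : PolyTimePred fun a => ∀ b ∈ l a, p a b := by
  classical
  have hfoldl (a : α) (l' : List β) (c : Bool) :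
      l'.foldl (fun s b => if p a b then s else [false]) [c] =
        [c && decide (∀ b ∈ l', p a b)] := by
    induction l' generalizing c with
    | nil => simp
    | cons b l' ih => by_cases h : p a b <;> simp [h, ih]
  refine (PolyTime.foldl (step := fun a s b => if p a b then s else [false]) hl
    (PolyTime.const [true])
    (PolyTime.ite (hp.comp (PolyTime.id.fst.pair PolyTime.id.snd.snd)) PolyTime.id.snd.fst
      (.const [false])) (.const _ 1) fun a l' _ => ?_).of_eq fun a => ?_
  · rw [hfoldl]
    exact le_rfl
  · simp only [hfoldl, Bool.true_and, List.cons.injEq, and_true, decide_eq_decide]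

theorem string_eq : PolyTimePred fun x : List Bool × List Bool => x.1 = x.2 := by
  have hiter : PolyTime fun x : List Bool × List Bool => stripCommonHead^[x.1.length] x := by
    refine PolyTimeMap.iterate (cnt := fun x : List Bool × List Bool => x.1)
      (st := fun x k => enc (stripCommonHead^[k] x)) PolyTime.id.fst PolyTime.id ?_
      (.refl fun x : List Bool × List Bool => (enc x).length) fun x k => ?_
    · simp only [Function.iterate_succ_apply']
      exact PolyTimeMap.reindex polyTime_stripCommonHead
        fun x : (List Bool × List Bool) × ℕ => stripCommonHead^[x.2] x.1
    · obtain ⟨h₁, h₂⟩ := length_iterate_stripCommonHead_le x k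
      have h := length_enc_prod (stripCommonHead^[k] x).1 (stripCommonHead^[k] x).2
      have h' := length_enc_prod x.1 x.2
      simp only [Prod.mk.eta] at h h'
      rw [h, h']
      exact Nat.add_le_add (by gcongr; exact h₁) h₂
  have hnil : PolyTimePred fun w : List Bool => w = [] :=
    (PolyTime.string_casesOn PolyTime.id (.const [true]) fun _ => .const [false]).of_eq fun w => by
      cases w <;> simp
  exact ((hnil.comp hiter.fst).and (hnil.comp hiter.snd)).of_iff fun x => by
    rw [← iterate_stripCommonHead_eq_nil_iff, Prod.ext_iff]

theorem eq [InjBitEncodable β] {f g : α → β} (hf : PolyTime f) (hg : PolyTime g) :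
    PolyTimePred fun a => f a = g a := by
  have h : PolyTime fun a => (enc (f a), enc (g a)) := PolyTimeMap.pair hf hg
  exact (string_eq.comp h).of_iff fun a => InjBitEncodable.enc_injective.eq_iff

theorem mem [InjBitEncodable β] {f : α → β} {l : α → List β} (hf : PolyTime f)
    (hl : PolyTime l) : PolyTimePred fun a => f a ∈ l a :=
  (forall_mem (p := fun a b => ¬ f a = b) hl
    (eq (hf.comp PolyTime.id.fst) PolyTime.id.snd).not).not.of_iff fun a => by simp

end PolyTimePred

theorem PolyTime.of_finite {α β : Type*} [BitEncodable α] [BitEncodable β] [Finite α]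
    [InjBitEncodable α] (f : α → β) : PolyTime f := by
  classical
  rcases isEmpty_or_nonempty α with h | ⟨⟨a₀⟩⟩
  · exact ⟨.skip, trivial, 0, .const _ 0, isEmptyElim⟩
  have hlist (l : List α) : PolyTime fun a => if a ∈ l then f a else f a₀ := by
    induction l with
    | nil => simpa using const (f a₀)
    | cons b l ih =>
        refine (ite (PolyTimePred.eq id (const b)) (const (f b)) ih).of_eq fun a => ?_
        by_cases h : a = b <;> simp [h]
  have := Fintype.ofFinite α
  simpa using hlist Finset.univ.toList

/-! ### Elimination in polynomial time -/

instance (m : ℕ) : BitEncodable (ZMod m) := ⟨fun x => encNat x.val⟩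

instance (m : ℕ) [NeZero m] : InjBitEncodable (ZMod m) :=
  ⟨fun _ _ h => ZMod.val_injective m (encNat_injective h)⟩

theorem exists_length_enc_le (α : Type*) [BitEncodable α] [Finite α] :
    ∃ κ : ℕ, ∀ x : α, (enc x).length ≤ κ := by
  obtain ⟨κ, hκ⟩ := (Set.finite_range fun x : α => (enc x).length).bddAbove
  exact ⟨κ, fun x => hκ ⟨x, rfl⟩⟩

theorem length_enc_zip_le {β γ : Type*} [BitEncodable β] [BitEncodable γ] (v : List β)
    (w : List γ) : (enc (v.zip w)).length ≤ 2 * (enc v).length + (enc w).length := by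
  induction v generalizing w with
  | nil => simp [enc_nil]
  | cons b v ih =>
      rcases w with _ | ⟨c, w⟩
      · simp [enc_nil]
      · have := ih w
        simp only [List.zip_cons_cons, length_enc_cons, length_enc_prod]
        omega

namespace PolyTime

variable {α β γ : Type*} [BitEncodable α] [BitEncodable β] [BitEncodable γ]

theorem list_headD {l : α → List β} (hl : PolyTime l) (b : β) : PolyTime fun a => (l a).headD b :=
  (list_casesOn (g := fun _ c _ => c) hl (const b) id.snd.fst).of_eq fun a => by
    cases l a <;> rfl

theorem list_tail {l : α → List β} (hl : PolyTime l) : PolyTime fun a => (l a).tail :=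
  (list_casesOn (g := fun _ _ t => t) hl (const []) id.snd.snd).of_eq fun a => by
    cases l a <;> rfl

theorem list_zip {l : α → List β} {l' : α → List γ} (hl : PolyTime l) (hl' : PolyTime l') :
    PolyTime fun a => (l a).zip (l' a) := by
  let step (s : List (β × γ) × List γ) (b : β) : List (β × γ) × List γ :=
    List.casesOn s.2 s fun c t => (s.1 ++ [(b, c)], t)
  have hstep : PolyTime fun x : α × (List (β × γ) × List γ) × β => step x.2.1 x.2.2 :=
    list_casesOn (g := fun x c t => (x.2.1.1 ++ [(x.2.2, c)], t)) id.snd.fst.snd id.snd.fst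
      ((id.fst.snd.fst.fst.append ((id.fst.snd.snd.pair id.snd.fst).cons (const []))).pair
        id.snd.snd)
  have hfoldl (v : List β) (u : List (β × γ)) (w : List γ) :
      v.foldl step (u, w) = (u ++ v.zip w, w.drop v.length) := by
    induction v generalizing u w with
    | nil => simp
    | cons b v ih => cases w <;> simp [step, ih]
  refine (foldl (step := fun _ s b => step s b) (init := fun a => ([], l' a)) hl
    ((const []).pair hl') hstep
    (((hl.length_le.const_mul 4).add (hl'.length_le.const_mul 3)).add (.const _ 1))
    fun a v hv => ?_).fst.of_eq fun a => by simp [hfoldl]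
  obtain ⟨t, ht⟩ := hv
  have hv' : (enc v).length ≤ (enc (l a)).length := by
    rw [← ht, length_enc_append]
    omega
  have := length_enc_drop_le (l' a) v.length
  have := length_enc_zip_le v (l' a)
  rw [hfoldl, length_enc_prod, List.nil_append]
  omega

end PolyTime

section Elimination

variable {α : Type*} [BitEncodable α] {m : ℕ}

theorem length_enc_rows_le {κ : ℕ} (hκ : ∀ x : α, (enc x).length ≤ κ) {rows : List (List α)}
    {N B : ℕ} (hN : rows.length ≤ N) (hB : ∀ P ∈ rows, P.length ≤ B) :
    (enc rows).length ≤ N * (2 * (B * (2 * κ + 1)) + 1) :=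
  (length_enc_le_of_forall fun P hP => (length_enc_le_of_forall fun x _ => hκ x).trans
    (Nat.mul_le_mul_right _ (hB P hP))).trans (Nat.mul_le_mul_right _ hN)

theorem length_le_length_enc_of_mem {P : List α} {rows : List (List α)} (hP : P ∈ rows) :
    P.length ≤ (enc rows).length :=
  (length_le_length_enc P).trans (length_enc_le_of_mem hP)

theorem length_foldl_elimStep_le {B : ℕ} (rows : List (List (ZMod m)))
    {s : List (ZMod m) × List (List (ZMod m))}
    (hs : s.1.length ≤ B ∧ ∀ Q ∈ s.2, Q.length ≤ B) :
    ((rows.foldl elimStep s).1.length ≤ B ∧ ∀ Q ∈ (rows.foldl elimStep s).2, Q.length ≤ B) ∧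
      (rows.foldl elimStep s).2.length = s.2.length + rows.length := by
  induction rows generalizing s with
  | nil => simpa using hs
  | cons P rows ih =>
      obtain ⟨hbound, hlen⟩ := ih (s := elimStep s P) ⟨by simp [elimStep, rowComb, hs.1], by
        simp only [elimStep, List.forall_mem_cons]
        exact ⟨by simp [rowComb]; omega, hs.2⟩⟩
      refine ⟨hbound, hlen.trans ?_⟩
      simp [elimStep]
      omega

variable [NeZero m]

theorem length_elimFirst_le {B : ℕ} {rows : List (List (ZMod m))}
    (hB : ∀ P ∈ rows, P.length ≤ B) :
    (elimFirst rows).length ≤ rows.length + 1 ∧ ∀ P ∈ elimFirst rows, P.length ≤ B := by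
  rcases rows with _ | ⟨P, rows⟩
  · simp [elimFirst]
  obtain ⟨⟨hpivot, hout⟩, hlen⟩ := length_foldl_elimStep_le (B := B) (P :: rows) (s := (P, []))
    ⟨hB P List.mem_cons_self, by simp⟩
  refine ⟨Nat.succ_le_succ (hlen.trans (Nat.zero_add _)).le, List.forall_mem_cons.2 ⟨?_, hout⟩⟩
  simpa [projectPivot] using hpivot.trans (Nat.le_succ B)

theorem length_eliminate_le {κ : Type*} {B : ℕ} (cols : List κ) {rows : List (List (ZMod m))}
    (hB : ∀ P ∈ rows, P.length ≤ B) : (eliminate cols rows).length ≤ rows.length + cols.length ∧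
      ∀ P ∈ eliminate cols rows, P.length ≤ B := by
  induction cols generalizing rows with
  | nil => exact ⟨le_rfl, hB⟩
  | cons c cols ih =>
      obtain ⟨hlen, hbound⟩ := length_elimFirst_le hB
      obtain ⟨hlen', hbound'⟩ := ih hbound
      exact ⟨hlen'.trans (by simp; omega), hbound'⟩

theorem polyTime_rowComb : PolyTime fun x : (ZMod m × ZMod m) × List (ZMod m) × List (ZMod m) =>
    rowComb x.1 x.2.1 x.2.2 := by
  have hentry : PolyTime fun x : (ZMod m × ZMod m) × ZMod m × ZMod m =>
      x.1.1 * x.2.1 + x.1.2 * x.2.2 := .of_finite _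
  refine (PolyTime.map (f := fun (x : (ZMod m × ZMod m) × List (ZMod m) × List (ZMod m)) z =>
    x.1.1 * z.1 + x.1.2 * z.2) (PolyTime.id.snd.fst.list_zip PolyTime.id.snd.snd)
    (hentry.comp (PolyTime.id.fst.fst.pair PolyTime.id.snd))).of_eq fun x => ?_
  simp [rowComb, List.zip, List.map_zipWith]

theorem polyTime_elimStep :
    PolyTime fun x : (List (ZMod m) × List (List (ZMod m))) × List (ZMod m) =>
      elimStep x.1 x.2 := by
  have hbezout : PolyTime fun x : (List (ZMod m) × List (List (ZMod m))) × List (ZMod m) =>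
      bezout (x.1.1.headD 0) (x.2.headD 0) :=
    PolyTime.comp₂ (g := bezout) (.of_finite _) (PolyTime.id.fst.fst.list_headD 0)
      (PolyTime.id.snd.list_headD 0)
  have hrows := (PolyTime.id (α := (List (ZMod m) × List (List (ZMod m))) × List (ZMod m))).fst.fst
    |>.pair PolyTime.id.snd
  exact (polyTime_rowComb.comp (hbezout.fst.pair hrows)).pair
    ((polyTime_rowComb.comp (hbezout.snd.pair hrows)).list_tail.cons PolyTime.id.fst.snd)

theorem polyTime_foldl_elimStep : PolyTime fun x : List (ZMod m) × List (List (ZMod m)) =>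
    (x.1 :: x.2).foldl elimStep (x.1, []) := by
  obtain ⟨κ, hκ⟩ := exists_length_enc_le (ZMod m)
  have hn := PolyBounded.refl fun x : List (ZMod m) × List (List (ZMod m)) => (enc x).length
  have hrow := hn.mul (.const _ (2 * κ + 1))
  refine PolyTime.foldl (step := fun _ s P => elimStep s P)
    (l := fun x : List (ZMod m) × List (List (ZMod m)) => x.1 :: x.2)
    (init := fun x => (x.1, [])) PolyTime.id (PolyTime.id.fst.pair (.const []))
    (polyTime_elimStep.comp PolyTime.id.snd)
    (((hrow.const_mul 2).add (.const _ 1)).add (hn.mul ((hrow.const_mul 2).add (.const _ 1))))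
    fun x l hl => ?_
  obtain ⟨⟨hpivot, hout⟩, hlen⟩ := length_foldl_elimStep_le (B := (enc x).length) l
    (s := (x.1, [])) ⟨length_le_length_enc_of_mem (rows := x.1 :: x.2) List.mem_cons_self, by simp⟩
  have hrows := length_enc_rows_le hκ (N := (enc x).length) (by
    rw [hlen]
    exact (Nat.zero_add _).trans_le (hl.length_le.trans (length_le_length_enc (x.1 :: x.2)))) hout
  have hfst := (length_enc_le_of_forall fun y (_ : y ∈ (l.foldl elimStep (x.1, [])).1) =>
    hκ y).trans (Nat.mul_le_mul_right _ hpivot)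
  rw [← Prod.mk.eta (p := l.foldl elimStep (x.1, [])), length_enc_prod]
  omega

theorem polyTime_projectPivot : PolyTime (projectPivot (m := m)) := by
  have hmul : PolyTime fun x : List (ZMod m) × ZMod m => annihilator (x.1.headD 0) * x.2 :=
    PolyTime.comp₂ (g := fun a x : ZMod m => annihilator a * x) (.of_finite _)
      (PolyTime.id.fst.list_headD 0) PolyTime.id.snd
  exact (PolyTime.map (f := fun (P : List (ZMod m)) x => annihilator (P.headD 0) * x)
    PolyTime.id hmul).list_tail

theorem polyTime_elimFirst : PolyTime (elimFirst (m := m)) := by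
  have hfoldl := polyTime_foldl_elimStep (m := m) |>.comp
    (PolyTime.id (α := List (List (ZMod m)) × List (ZMod m) × List (List (ZMod m)))).snd
  refine (PolyTime.list_casesOn (f := fun _ => []) (g := fun _ P rows =>
    projectPivot ((P :: rows).foldl elimStep (P, [])).1 ::
      ((P :: rows).foldl elimStep (P, [])).2) PolyTime.id (.const [])
    ((polyTime_projectPivot.comp hfoldl.fst).cons hfoldl.snd)).of_eq fun rows => ?_
  cases rows <;> rfl

theorem PolyTime.eliminate {β κ : Type*} [BitEncodable β] [BitEncodable κ] {cols : β → List κ}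
    {rows : β → List (List (ZMod m))} (hcols : PolyTime cols) (hrows : PolyTime rows) :
    PolyTime fun b => eliminate (cols b) (rows b) := by
  obtain ⟨κ, hκ⟩ := exists_length_enc_le (ZMod m)
  refine foldl (step := fun _ rows _ => elimFirst rows) hcols hrows
    (polyTime_elimFirst.comp id.snd.fst)
    ((hrows.length_le.add hcols.length_le).mul
      (((hrows.length_le.mul (.const _ (2 * κ + 1))).const_mul 2).add (.const _ 1)))
    fun b l hl => ?_
  obtain ⟨hlen, hbound⟩ := length_eliminate_le l (rows := rows b)
    fun P hP => length_le_length_enc_of_mem hP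
  exact length_enc_rows_le hκ (hlen.trans (Nat.add_le_add (length_le_length_enc _)
    (hl.length_le.trans (length_le_length_enc _)))) hbound

end Elimination

/-! ### The algorithm -/

instance : BitEncodable LPSystem := ⟨LPSystem.enc⟩

instance {s : ℕ} {ar : Fin s → ℕ} : BitEncodable (Formula ar) := ⟨Formula.enc⟩

section FixedList

variable {α β κ : Type*} [BitEncodable α] [BitEncodable β]

theorem PolyTime.list_getD {l : α → List β} (hl : PolyTime l) (n : ℕ) (d : β) :
    PolyTime fun a => (l a).getD n d := by
  induction n generalizing l with
  | zero => exact (hl.list_headD d).of_eq fun a => by cases l a <;> rfl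
  | succ n ih => exact (ih hl.list_tail).of_eq fun a => by cases l a <;> rfl

theorem PolyTime.const_list_map (L : List κ) {f : κ → α → β} (hf : ∀ k, PolyTime (f k)) :
    PolyTime fun a => L.map fun k => f k a := by
  induction L with
  | nil => exact const []
  | cons k L ih => exact (hf k).cons ih

theorem PolyTime.const_list_flatMap (L : List κ) {f : κ → α → List β}
    (hf : ∀ k, PolyTime (f k)) : PolyTime fun a => L.flatMap fun k => f k a := by
  induction L with
  | nil => exact const []
  | cons k L ih => exact (hf k).append ih

theorem PolyTimePred.forall_of_finite [Finite κ] {p : κ → α → Prop}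
    (hp : ∀ k, PolyTimePred (p k)) : PolyTimePred fun a => ∀ k, p k a := by
  have hlist (L : List κ) : PolyTimePred fun a => ∀ k ∈ L, p k a := by
    induction L with
    | nil => exact (PolyTime.const [true]).of_eq fun a => by simp
    | cons k L ih => exact ((hp k).and ih).of_iff fun a => by simp
  have := Fintype.ofFinite κ
  exact (hlist Finset.univ.toList).of_iff fun a => by simp

end FixedList

section Systems

theorem PolyTime.coef (R : Type*) [Ring R] [BitEncodable R] {α : Type*} [BitEncodable α]
    {r : α → LinRow} {g : α → Name} (hr : PolyTime r) (hg : PolyTime g) :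
    PolyTime fun a => (coef (r a) (g a) : R) := by
  refine (ite (.mem hg hr.fst) (ite (.mem hg hr.snd) (const 0) (const 1))
    (ite (.mem hg hr.snd) (const (-1)) (const 0))).of_eq fun a => ?_
  simp only [PromiseCSP.coef]
  split_ifs <;> simp

theorem length_enc_foldl_insertName_le (l s : List Name) :
    (enc (l.foldl insertName s)).length ≤ (enc s).length + (enc l).length := by
  induction l generalizing s with
  | nil => exact le_self_add
  | cons γ l ih =>
      refine (ih _).trans ?_
      have hinsert : (enc (insertName s γ)).length ≤ (enc (γ :: s)).length := by
        rw [insertName, List.insert]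
        split_ifs <;> simp only [length_enc_cons] <;> omega
      simp only [length_enc_cons] at hinsert ⊢
      omega

theorem polyTime_insertName : PolyTime fun x : List Name × Name => insertName x.1 x.2 := by
  refine (PolyTime.ite (.eq PolyTime.id.snd (.const [])) PolyTime.id.fst
    (.ite (.mem PolyTime.id.snd PolyTime.id.fst) PolyTime.id.fst
      (PolyTime.id.snd.cons PolyTime.id.fst))).of_eq fun x => ?_
  simp only [insertName, List.insert, List.elem_eq_mem, decide_eq_true_eq]

theorem polyTime_unknowns : PolyTime unknowns := by
  have hnames : PolyTime fun rs : List LinRow => rs.flatMap fun r => r.1 ++ r.2 :=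
    .flatMap (f := fun _ (r : LinRow) => r.1 ++ r.2) .id
      (PolyTime.id.snd.fst.append PolyTime.id.snd.snd)
  refine .foldl (step := fun _ => insertName) hnames (.const [])
    (polyTime_insertName.comp PolyTime.id.snd) hnames.length_le fun rs l hl => ?_
  refine (length_enc_foldl_insertName_le l []).trans ?_
  obtain ⟨t, ht⟩ := hl
  simp only [← ht, length_enc_append, enc_nil, List.length_nil]
  omega

theorem polyTime_coefMatrix (R : Type*) [Ring R] [BitEncodable R]
    {F : List LinRow → List LinRow} (hF : PolyTime F) : PolyTime fun rs =>
      (F rs).map fun r => (unknowns rs ++ [[]]).map fun γ => (coef r γ : R) :=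
  .map (f := fun rs r => (unknowns rs ++ [[]]).map fun γ => (coef r γ : R)) hF
    (.map (f := fun (x : List LinRow × LinRow) γ => (coef x.2 γ : R))
      ((polyTime_unknowns.comp PolyTime.id.fst).append (.const [[]]))
      (.coef R PolyTime.id.fst.snd PolyTime.id.snd))

theorem polyTime_augmentedMatrix (m : ℕ) : PolyTime (augmentedMatrix m) :=
  polyTime_coefMatrix (ZMod m) .id

theorem polyTime_lpRows : PolyTime lpRows := by
  have hswap : PolyTime fun rs : List LinRow => rs.map fun r => (r.2, r.1) :=
    .map (f := fun _ (r : LinRow) => (r.2, r.1)) .id (PolyTime.id.snd.snd.pair PolyTime.id.snd.fst)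
  have hnonneg : PolyTime fun rs => (unknowns rs).map fun γ => (([], [γ]) : LinRow) :=
    .map (f := fun _ γ => (([], [γ]) : LinRow)) polyTime_unknowns
      (.pair (.const []) (PolyTime.id.snd.cons (.const [])))
  exact (PolyTime.id.append hswap).append hnonneg

theorem enc_lpSystem (rs : List LinRow) : enc (lpSystem rs) =
    enc (encUnary (unknowns rs).length,
      [(lpRows rs).map fun r => (unknowns rs ++ [[]]).map fun γ => coef r γ]) := by
  have hrows : (List.ofFn fun i => encList ((List.ofFn fun j => encInt ((lpSystem rs).mat i j)) ++
      [encInt ((lpSystem rs).rhs i)])) =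
      ((lpRows rs).map fun r => (unknowns rs ++ [[]]).map fun γ => coef r γ).map enc := by
    rw [List.map_map, ← List.ofFn_getElem_eq_map]
    congr 1
    funext i
    simp only [Function.comp_apply, enc, List.map_append, List.map_map, List.map_cons,
      List.map_nil]
    rw [← List.ofFn_getElem_eq_map]
    rfl
  change (lpSystem rs).enc = _
  rw [LPSystem.enc, hrows]
  simp [encList, enc, lpSystem]

theorem PolyTime.encUnary_length {α β : Type*} [BitEncodable α] [BitEncodable β]
    {l : α → List β} (hl : PolyTime l) : PolyTime fun a => encUnary (l a).length := by
  have hfoldl (l : List β) (w : List Bool) :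
      l.foldl (fun w _ => true :: w) w = encUnary l.length ++ w := by
    induction l generalizing w with
    | nil => rfl
    | cons b l ih =>
        rw [List.foldl_cons, ih, List.length_cons, encUnary, encUnary, List.replicate_succ',
          List.append_assoc, List.singleton_append]
  refine (foldl (step := fun _ w _ => true :: w) hl (const ([] : List Bool))
    (id.snd.fst.string_cons true) hl.length_le fun a l' hl' => ?_).of_eq fun a => by
      rw [hfoldl, List.append_nil]
  rw [hfoldl, List.append_nil]
  exact (List.length_replicate ..).trans_le (hl'.length_le.trans (length_le_length_enc _))

theorem polyTime_lpSystem : PolyTime lpSystem := by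
  have h := polyTime_unknowns.encUnary_length.pair
    ((polyTime_coefMatrix ℤ polyTime_lpRows).cons (.const []))
  simp only [PolyTime, enc_lpSystem]
  exact h

theorem polyTimePred_feasibleIn {A : Subring ℝ} {ρ : RingRep A} (h : ρ.IsLPSolvable) :
    PolyTimePred (LPSystem.FeasibleIn A) := by
  obtain ⟨out, hout, hsolves⟩ := PolyTimeMap.of_polyTimeSolvable h.2
  have hout' : PolyTime out := hout
  refine (hout'.string_casesOn (f := fun _ => [false]) (g := fun b _ => [b]) (.const _)
    fun b => .const _).of_eq fun Λ => ?_
  rcases hsolves Λ with ⟨u, hu, hΛ⟩ | ⟨hu, hΛ⟩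
  · have : LPSystem.FeasibleIn A Λ := ⟨fun j => (u j).val, hu⟩
    simp [hΛ, this]
  · have : ¬ LPSystem.FeasibleIn A Λ := hu
    simp [hΛ, this]

end Systems

section Formulas

variable {E : Type*} {φ : Bool → E} (Γ : PromiseTemplate Bool E φ)

theorem polyTime_clauseRowsAt (i : Fin Γ.size) : PolyTime (clauseRowsAt Γ i) := by
  have hweights (T : List (Fin (Γ.ar i) → Bool)) :
      PolyTime fun c : Name => T.map fun p => weightName c p :=
    .const_list_map T fun p => .cons (.const (List.ofFn p)) .id
  exact (((hweights _).append (.const [[]])).pair (.const [])).cons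
    (.const_list_map _ fun k => (hweights _).pair
      (((PolyTime.id.list_getD (k + 1) []).cons (.const [])).cons (.const [])))

theorem polyTime_formulaRows : PolyTime (formulaRows Γ) := by
  have hclause : PolyTime (clauseRows Γ) := .const_list_flatMap _ fun i =>
    .ite (.eq (PolyTime.id.list_headD []) (.const (encNat i))) (polyTime_clauseRowsAt Γ i)
      (.const [])
  exact .flatMap (f := fun _ c => clauseRows Γ c) .id (hclause.comp PolyTime.id.snd)

theorem enc_formula {s : ℕ} {ar : Fin s → ℕ} (Ψ : Formula ar) :
    enc Ψ = enc (encUnary Ψ.numVars, Ψ.clauses.map clauseName) := by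
  change Ψ.enc = _
  simp only [Formula.enc, enc, encList, List.flatMap_cons, List.map_map]
  congr 2
  refine List.map_congr_left fun cl _ => ?_
  simp [clauseName]

theorem clauseNames_eq_of_enc_eq {s : ℕ} {ar : Fin s → ℕ} {Ψ Ψ' : Formula ar}
    (h : Ψ.enc = Ψ'.enc) : Ψ.clauses.map clauseName = Ψ'.clauses.map clauseName :=
  congrArg Prod.snd (InjBitEncodable.enc_injective
    ((enc_formula Ψ).symm.trans (h.trans (enc_formula Ψ'))))

theorem polyTime_clauseNames {s : ℕ} {ar : Fin s → ℕ} :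
    PolyTime fun Ψ : Formula ar => Ψ.clauses.map clauseName := by
  have h : PolyTime fun Ψ : Formula ar => (encUnary Ψ.numVars, Ψ.clauses.map clauseName) := by
    simp only [PolyTime, ← enc_formula]
    exact .refl _
  exact h.snd

/-- The test performed by the algorithm on the list of the names of the clauses: the linear system
is solvable over each of the rings `A j` with nonnegative unknowns, and it is solvable
modulo `m`. -/
def RelaxationsSolvable {b : ℕ} (A : Fin b → Subring ℝ) (m : ℕ) (cs : List Name) : Prop :=
  (∀ j, ∃ y : Name → A j, Solves (formulaRows Γ cs) y ∧
      ∀ γ ∈ unknowns (formulaRows Γ cs), 0 ≤ (y γ : ℝ)) ∧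
    ∃ y : Name → ZMod m, Solves (formulaRows Γ cs) y

variable {Γ}

theorem polyTimePred_relaxationsSolvable {b : ℕ} {A : Fin b → Subring ℝ}
    (hA : ∀ j, PolyTimePred (LPSystem.FeasibleIn (A j))) (m : ℕ) [NeZero m] :
    PolyTimePred fun Ψ : Formula Γ.ar =>
      RelaxationsSolvable Γ A m (Ψ.clauses.map clauseName) := by
  have hrows : PolyTime fun Ψ : Formula Γ.ar => formulaRows Γ (Ψ.clauses.map clauseName) :=
    (polyTime_formulaRows Γ).comp polyTime_clauseNames
  have hlp := PolyTimePred.forall_of_finite fun j => (hA j).comp (polyTime_lpSystem.comp hrows)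
  have hzmod := PolyTimePred.forall_mem (p := fun _ (P : List (ZMod m)) => P.headD 0 = 0)
    (.eliminate (polyTime_unknowns.comp hrows) ((polyTime_augmentedMatrix m).comp hrows))
    (.eq (PolyTime.id.snd.list_headD 0) (.const 0))
  refine (hlp.and hzmod).of_iff fun Ψ => ?_
  have hsimple := simple_formulaRows Ψ.clauses
  simp only [RelaxationsSolvable, feasibleIn_lpSystem_iff hsimple, exists_solves_zmod_iff hsimple]

theorem relaxationsSolvable_of_satisfiable {b : ℕ} (A : Fin b → Subring ℝ) (m : ℕ)
    {Ψ : Formula Γ.ar} (h : Ψ.Satisfiable Γ.P) :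
    RelaxationsSolvable Γ A m (Ψ.clauses.map clauseName) := by
  obtain ⟨x, hx⟩ := h
  exact ⟨fun j => ⟨_, solves_assignmentSolution (A j) hx, fun γ hγ =>
    assignmentSolution_nonneg (A j) x (ne_of_mem_of_not_mem hγ (nil_notMem_unknowns _))⟩,
    _, solves_assignmentSolution (ZMod m) hx⟩

theorem pcsp_mem_polyTimeClass (O : List Bool → List Bool) {p : List Name → Prop}
    (hp : PolyTimePred fun Ψ : Formula Γ.ar => p (Ψ.clauses.map clauseName))
    (haccept : ∀ Ψ : Formula Γ.ar, Ψ.Satisfiable Γ.P → p (Ψ.clauses.map clauseName))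
    (hreject : ∀ Ψ : Formula Γ.ar, p (Ψ.clauses.map clauseName) → Ψ.Satisfiable Γ.Q) :
    Γ.PCSP ∈ PolyTimeClass O := by
  classical
  refine PolyTimeMap.mem_polyTimeClass O hp fun w hw => ?_
  obtain ⟨Ψ, rfl⟩ : ∃ Ψ : Formula Γ.ar, Ψ.enc = w := by
    rcases hw with ⟨Ψ, hΨ, -⟩ | ⟨Ψ, hΨ, -⟩ <;> exact ⟨Ψ, hΨ.symm⟩
  refine ⟨Ψ, rfl, ?_, ?_⟩
  · rintro ⟨Ψ', henc, hsat⟩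
    have : p (Ψ.clauses.map clauseName) := clauseNames_eq_of_enc_eq henc ▸ haccept Ψ' hsat
    exact congrArg (fun b => [b]) (decide_eq_true this)
  · rintro ⟨Ψ', henc, hunsat⟩
    have : ¬ p (Ψ.clauses.map clauseName) := fun h =>
      hunsat (hreject Ψ' (clauseNames_eq_of_enc_eq henc ▸ h))
    exact congrArg (fun b => [b]) (decide_eq_false this)

end Formulas

end PromiseCSP

theorem mainTheorem1_general
    {b : ℕ} (A : Fin b → Subring ℝ) (hdense : ∀ j, Dense (A j : Set ℝ))
    (hLP : ∀ j, PolyTimePred (LPSystem.FeasibleIn (A j)))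
    {S : Type*} [Finite S] (Part : cube A → S) (hPart : IsOpenPartition Part)
    {E : Type*} (J : S → Ideal (Fin b → ℤ)) (hJ : ∀ k, Finite ((Fin b → ℤ) ⧸ J k))
    (M : (k : S) → ((Fin b → ℤ) ⧸ J k) → E)
    {φ : Bool → E} (Γ : PromiseTemplate Bool E φ)
    (hpol : ∀ ℓ : ℕ, 0 < ℓ → ∃ (L : ℕ) (blk : Fin L → Fin b) (hblk : Admissible Part blk),
      (∀ j, ℓ ≤ blockSize blk j) ∧ Γ.IsPolymorphism (regPer Part J M blk hblk))
    (O : List Bool → List Bool) : Γ.PCSP ∈ PolyTimeClass O := by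
  obtain ⟨m, hm₀, hm⟩ := exists_natCast_mem_ideals J hJ
  have : NeZero m := ⟨hm₀.ne'⟩
  exact pcsp_mem_polyTimeClass O (polyTimePred_relaxationsSolvable hLP m)
    (fun Ψ => relaxationsSolvable_of_satisfiable A m)
    fun Ψ hΨ => satisfiable_of_solves hdense hPart hpol hm Ψ hΨ.1 hΨ.2

theorem mainTheorem1
    {b : ℕ} (A : Fin b → Subring ℝ) (ρ : (j : Fin b) → RingRep (A j))
    (hdense : ∀ j, Dense (A j : Set ℝ)) (hA : ∀ j, (ρ j).IsLPSolvable)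
    {s : ℕ} (Part : cube A → Fin s) (hPart : IsOpenPartition Part)
    {E : Type*} [Finite E]
    (J : Fin s → Ideal (Fin b → ℤ)) (hJ : ∀ k, Finite ((Fin b → ℤ) ⧸ J k))
    (M : (k : Fin s) → ((Fin b → ℤ) ⧸ J k) → E)
    {φ : Bool → E} (Γ : PromiseTemplate Bool E φ)
    (hpol : ∀ ℓ : ℕ, 0 < ℓ → ∃ (L : ℕ) (blk : Fin L → Fin b) (hblk : Admissible Part blk),
      (∀ j, ℓ ≤ blockSize blk j) ∧ Γ.IsPolymorphism (regPer Part J M blk hblk)) :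
    Γ.PCSP ∈ PolyTimeClass (partOracle ρ Part) :=
  mainTheorem1_general A hdense (fun j => polyTimePred_feasibleIn (hA j)) Part hPart J hJ M Γ hpol
    (partOracle ρ Part)
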